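/- Let $p_0,p_1$ be non-negative integers, $p=p_0+p_1$, $\gamma\in(0,1)$, and let $\rho_0\in\mathbb{R}^{p_1}$ have only non-zero coordinates. Let $\Theta_0\subset\mathbb{R}^{p_0}$ and $\Theta_1\subset\mathbb{R}^{p_1}$ be compact with $0\in\Theta_0^\circ$, $\rho_0\in\Theta_1^\circ$. For every $n\ge1$ let $X_i=(X_i^{(z)},X_i^{(\rho)})\in\mathbb{R}^{p_0}\times\mathbb{R}^{p_1}$, $i=1,\dots,n$, be non-random covariates (which may depend on $n$), and let $Y_i=\rho_0^\top X_i^{(\rho)}+\epsilon_i$, $i=1,\dots,n$, that is, $Y_i=\theta_0^\top X_i+\epsilon_i$ with $\theta_0=(0,\rho_0)$. Let $\hat\theta_n=(\hat z_n,\hat\rho_n)$ be any (measurable) minimizer over $(z,\rho)\in\Theta_0\times\Theta_1$ of $$Z_n(z,\rho)=\sum_{i=1}^n\big(Y_i-z^\top X_i^{(z)}-\rho^\top X_i^{(\rho)}\big)^2+\lambda_n\sum_{k=1}^{p_0}|z_k|^\gamma+\lambda_n\sum_{l=1}^{p_1}|\rho_l|^\gamma .$$ Let $C_n=n^{-1}\sum_{i=1}^n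 X_iX_i^\top$, let $D_n$ be its upper left $p_0\times p_0$ block and $B_n$ its bottom right $p_1\times p_1$ block. Suppose that 1. $\lambda_n/n^{\gamma/2}\to\infty$ and $\lambda_n/\sqrt n\to\lambda_0\ge0$; 2. $\epsilon_1,\epsilon_2,\dots$ are i.i.d. with $E[\epsilon_i]=0$ and $E[|\epsilon_i|^k]<\infty$ for all $k>0$; put $\sigma^2=E[\epsilon_1^2]$; 3. $\sup_{n>0}\sup_{i\le n}|X_i|<\infty$; 4. $D_n\to D_0$ for some positive definite $D_0$; 5. $\sup_{n>0}n^\delta|B_n-B_0|<\infty$ for some $\delta>0$ and some positive definite $B_0$; 6. $\sup_{n>0}\big|n^{-1/2}\sum_{i=1}^n X_i^{(z)}\otimes X_i^{(\rho)}\big|<\infty$. Then for every $L>0$ there is a constant $c_L>0$ such that $$\sup_{n>0}P\Big(\max\big\{|\sqrt n\,\hat z_n|,\ |\sqrt n(\hat\rho_n-\rho_0)|\big\}\ge r\Big)\le\frac{c_L}{r^L}\qquad\text{for all } r>0 .$$ Moreover, for every continuous $f:\mathbb{R}^p\to\mathbb{R}$ of at most polynomial growth the following expectations exist and $$E\big[f\big(\sqrt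 n\,\hat z_n,\sqrt n(\hat\rho_n-\rho_0)\big)\big]\to E[f(0,\hat v_0)],\qquad \hat v_0\sim N_{p_1}\big(-\lambda_0B_0^{-1}\Upsilon,\ \sigma^2B_0^{-1}\big),$$ where $\Upsilon=\frac{\gamma}{2}\big(\mathrm{sgn}(\rho_{0,l})|\rho_{0,l}|^{\gamma-1}\big)_{l=1}^{p_1}$. -/

import Mathlib

open MeasureTheory ProbabilityTheory Filter Topology

namespace SparseBridge

/-- Vectors `(z, ρ)` of `ℝ^{p₀} × ℝ^{p₁}`, each block carrying the Euclidean norm; the norm of a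
pair is the maximum of the Euclidean norms of its two blocks. -/
abbrev Vec (p₀ p₁ : ℕ) : Type :=
  EuclideanSpace ℝ (Fin p₀) × EuclideanSpace ℝ (Fin p₁)

/-- The scalar product `θᵀ x = zᵀ x^{(z)} + ρᵀ x^{(ρ)}`. -/
noncomputable def dot {p₀ p₁ : ℕ} (θ x : Vec p₀ p₁) : ℝ :=
  (∑ k, θ.1 k * x.1 k) + ∑ l, θ.2 l * x.2 l

/-- The linear regression model `Y_{n,i} = θ₀ᵀ X_{n,i} + ε_i`. Observations are numbered from
zero, so that the `n`-th sample consists of the indices `i < n`. The design may depend on `n`. -/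
noncomputable def response {Ω : Type*} {p₀ p₁ : ℕ} (X : ℕ → ℕ → Vec p₀ p₁) (ε : ℕ → Ω → ℝ)
    (θ₀ : Vec p₀ p₁) (n i : ℕ) (ω : Ω) : ℝ :=
  dot θ₀ (X n i) + ε i ω

/-- The bridge contrast `∑_{i<n} (y_i - θᵀ x_i)² + lam ∑_j |θ_j|^γ`. -/
noncomputable def contrast {p₀ p₁ : ℕ} (n : ℕ) (x : ℕ → Vec p₀ p₁) (y : ℕ → ℝ) (lam γ : ℝ)
    (θ : Vec p₀ p₁) : ℝ :=
  (∑ i ∈ Finset.range n, (y i - dot θ (x i)) ^ 2)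
    + lam * (∑ k, |θ.1 k| ^ γ) + lam * ∑ l, |θ.2 l| ^ γ

/-- `C_n = n⁻¹ ∑_{i<n} x_i x_iᵀ`. -/
noncomputable def gram {p₀ p₁ : ℕ} (n : ℕ) (x : ℕ → Vec p₀ p₁) :
    Matrix (Fin p₀ ⊕ Fin p₁) (Fin p₀ ⊕ Fin p₁) ℝ :=
  (n : ℝ)⁻¹ • ∑ i ∈ Finset.range n,
    Matrix.vecMulVec (Sum.elim (x i).1.ofLp (x i).2.ofLp) (Sum.elim (x i).1.ofLp (x i).2.ofLp)

/-- The upper left `p₀ × p₀` block `D_n` of `C_n`. -/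
noncomputable def gramZ {p₀ p₁ : ℕ} (n : ℕ) (x : ℕ → Vec p₀ p₁) : Matrix (Fin p₀) (Fin p₀) ℝ :=
  (gram n x).toBlocks₁₁

/-- The bottom right `p₁ × p₁` block `B_n` of `C_n`. -/
noncomputable def gramRho {p₀ p₁ : ℕ} (n : ℕ) (x : ℕ → Vec p₀ p₁) :
    Matrix (Fin p₁) (Fin p₁) ℝ :=
  (gram n x).toBlocks₂₂

/-- `n^{-1/2} ∑_{i<n} x_i^{(z)} ⊗ x_i^{(ρ)}`. -/
noncomputable def cross {p₀ p₁ : ℕ} (n : ℕ) (x : ℕ → Vec p₀ p₁) : Matrix (Fin p₀) (Fin p₁) ℝ :=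
  (√(n : ℝ))⁻¹ • ∑ i ∈ Finset.range n, Matrix.vecMulVec (x i).1.ofLp (x i).2.ofLp

/-- The Frobenius norm of a matrix. -/
noncomputable def frobNorm {m k : ℕ} (A : Matrix (Fin m) (Fin k) ℝ) : ℝ :=
  √(∑ i, ∑ j, A i j ^ 2)

/-- `Υ_l = (γ / 2) sgn(ρ_{0,l}) |ρ_{0,l}|^{γ-1}`. -/
noncomputable def upsilon {p₁ : ℕ} (γ : ℝ) (ρ₀ : EuclideanSpace ℝ (Fin p₁)) (l : Fin p₁) : ℝ :=
  γ / 2 * (Real.sign (ρ₀ l) * |ρ₀ l| ^ (γ - 1))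

/-- The rescaled estimation error `(√n z, √n (ρ - ρ₀))`. -/
noncomputable def scaledError {p₀ p₁ : ℕ} (ρ₀ : EuclideanSpace ℝ (Fin p₁)) (n : ℕ)
    (θ : Vec p₀ p₁) : Vec p₀ p₁ :=
  (√(n : ℝ) • θ.1, √(n : ℝ) • (θ.2 - ρ₀))

/-- The limit law `N_{p₁}(-lam₀ B₀⁻¹ Υ, s B₀⁻¹)`, where `s` is the noise variance. -/
noncomputable def limitLaw {p₁ : ℕ} (γ lam₀ s : ℝ) (B₀ : Matrix (Fin p₁) (Fin p₁) ℝ)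
    (ρ₀ : EuclideanSpace ℝ (Fin p₁)) : Measure (EuclideanSpace ℝ (Fin p₁)) :=
  multivariateGaussian (WithLp.toLp 2 (-(lam₀ • B₀⁻¹.mulVec (upsilon γ ρ₀)))) (s • B₀⁻¹)

end SparseBridge

namespace SparseBridge

/-! ### Moments of weighted sums of independent centered variables -/

theorem exists_abs_add_pow_sub_le (N : ℕ) : ∃ A : ℝ, 0 ≤ A ∧ ∀ s x : ℝ,
    |(s + x) ^ (N + 2) - s ^ (N + 2) - (N + 2) * s ^ (N + 1) * x|
      ≤ A * (x ^ 2 * (|s| + |x|) ^ N) := by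
  induction N with
  | zero => exact ⟨1, zero_le_one, fun s x => le_of_eq <| by
      rw [show (s + x) ^ (0 + 2) - s ^ (0 + 2) - ((0 : ℕ) + 2) * s ^ (0 + 1) * x = x ^ 2 by
        push_cast; ring]
      simp⟩
  | succ N ih =>
    obtain ⟨A, hA, h⟩ := ih
    refine ⟨A + (N + 2), by positivity, fun s x => ?_⟩
    have key : (s + x) ^ (N + 1 + 2) - s ^ (N + 1 + 2)
        - ((N + 1 : ℕ) + 2) * s ^ (N + 1 + 1) * x
        = (s + x) * ((s + x) ^ (N + 2) - s ^ (N + 2) - (N + 2) * s ^ (N + 1) * x)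
          + (N + 2) * s ^ (N + 1) * x ^ 2 := by
      push_cast; ring
    rw [key]
    calc _ ≤ |s + x| * (A * (x ^ 2 * (|s| + |x|) ^ N)) + (N + 2) * |s| ^ (N + 1) * x ^ 2 := by
          refine (abs_add_le _ _).trans (add_le_add ?_ (le_of_eq ?_))
          · rw [abs_mul]; exact mul_le_mul_of_nonneg_left (h s x) (abs_nonneg _)
          · rw [abs_mul, abs_mul, abs_pow, abs_of_nonneg (sq_nonneg x),
              abs_of_nonneg (by positivity : (0 : ℝ) ≤ N + 2)]
      _ ≤ (|s| + |x|) * (A * (x ^ 2 * (|s| + |x|) ^ N))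
          + (N + 2) * (|s| + |x|) ^ (N + 1) * x ^ 2 := by
          gcongr
          · exact abs_add_le s x
          · linarith [abs_nonneg x]
      _ = _ := by ring

theorem exists_add_pow_even_le (m : ℕ) : ∃ A : ℝ, 0 ≤ A ∧ ∀ s x : ℝ,
    (s + x) ^ (2 * (m + 1)) ≤ s ^ (2 * (m + 1)) + (2 * m + 2) * (s ^ (2 * m + 1) * x)
      + A * (s ^ (2 * m) * x ^ 2) + A * x ^ (2 * (m + 1)) := by
  obtain ⟨A, hA, h⟩ := exists_abs_add_pow_sub_le (2 * m)
  refine ⟨A * 2 ^ (2 * m), by positivity, fun s x => ?_⟩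
  have h1 := (le_abs_self _).trans (h s x)
  have h2 : (|s| + |x|) ^ (2 * m) ≤ 2 ^ (2 * m) * (s ^ (2 * m) + x ^ (2 * m)) := by
    refine (add_pow_le (abs_nonneg s) (abs_nonneg x) _).trans ?_
    rw [(even_two_mul m).pow_abs, (even_two_mul m).pow_abs]
    have : 0 ≤ s ^ (2 * m) + x ^ (2 * m) :=
      add_nonneg ((even_two_mul m).pow_nonneg s) ((even_two_mul m).pow_nonneg x)
    gcongr
    · norm_num
    · omega
  have h3 : A * (x ^ 2 * (|s| + |x|) ^ (2 * m))
      ≤ A * (x ^ 2 * (2 ^ (2 * m) * (s ^ (2 * m) + x ^ (2 * m)))) := by gcongr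
  have e : 2 * (m + 1) = 2 * m + 2 := by ring
  rw [e]
  push_cast at h1
  have e2 : A * 2 ^ (2 * m) * (s ^ (2 * m) * x ^ 2) + A * 2 ^ (2 * m) * x ^ (2 * m + 2)
    = A * (x ^ 2 * (2 ^ (2 * m) * (s ^ (2 * m) + x ^ (2 * m)))) := by ring
  linarith

section Moments

variable {Ω : Type*} [MeasurableSpace Ω] {P : Measure Ω} [IsProbabilityMeasure P]
  {ε : ℕ → Ω → ℝ}

omit [IsProbabilityMeasure P] in
theorem memLp_sum_mul (hL : ∀ i, ∀ k : ℕ, MemLp (ε i) k P) (a : ℕ → ℝ) (n k : ℕ) :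
    MemLp (fun ω => ∑ i ∈ Finset.range n, a i * ε i ω) k P :=
  memLp_finsetSum _ fun i _ => (hL i k).const_mul (a i)

theorem integrable_pow_of_memLp {f : Ω → ℝ} (hf : ∀ k : ℕ, MemLp f k P) (k : ℕ) :
    Integrable (fun ω => f ω ^ k) P := by
  rcases Nat.eq_zero_or_pos k with rfl | hk
  · simp
  · have := (hf k).integrable_norm_pow hk.ne'
    refine this.mono ((hf k).1.pow k) (ae_of_all _ fun ω => by simp)

theorem exists_integral_sum_pow_le (hindep : iIndepFun ε P)
    (hL : ∀ i, ∀ k : ℕ, MemLp (ε i) k P) (hmean : ∀ i, ∫ ω, ε i ω ∂P = 0)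
    (hbd : ∀ k : ℕ, ∃ M : ℝ, ∀ i, ∫ ω, |ε i ω| ^ k ∂P ≤ M) (K : ℝ) (m : ℕ) :
    ∃ C : ℝ, 0 ≤ C ∧ ∀ (n : ℕ) (a : ℕ → ℝ), (∀ i < n, |a i| ≤ K) →
      ∫ ω, (∑ i ∈ Finset.range n, a i * ε i ω) ^ (2 * m) ∂P ≤ C * (n : ℝ) ^ m := by
  induction m with
  | zero => exact ⟨1, zero_le_one, fun n a _ => by simp⟩
  | succ m ih =>
    obtain ⟨C, hC, ih⟩ := ih
    obtain ⟨A, hA, hineq⟩ := exists_add_pow_even_le m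
    obtain ⟨M₂, hM₂⟩ := hbd 2
    obtain ⟨M, hM⟩ := hbd (2 * (m + 1))
    have hM₂0 : 0 ≤ M₂ := (integral_nonneg fun ω => by positivity).trans (hM₂ 0)
    have hM0 : 0 ≤ M := (integral_nonneg fun ω => by positivity).trans (hM 0)
    set C' : ℝ := A * (C * (K ^ 2 * M₂)) + A * (K ^ (2 * (m + 1)) * M) with hC'
    have hKe : 0 ≤ K ^ (2 * (m + 1)) := (even_two_mul _).pow_nonneg K
    have hC'0 : 0 ≤ C' := by positivity
    refine ⟨C', hC'0, fun n => ?_⟩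
    induction n with
    | zero => intro a _; simp
    | succ n ihn =>
      intro a ha
      have hK : |a n| ≤ K := ha n (Nat.lt_succ_self n)
      set S : Ω → ℝ := fun ω => ∑ i ∈ Finset.range n, a i * ε i ω with hS
      set ξ : Ω → ℝ := fun ω => a n * ε n ω with hξ
      have hSL : ∀ k : ℕ, MemLp S k P := fun k => memLp_sum_mul hL a n k
      have hξL : ∀ k : ℕ, MemLp ξ k P := fun k => (hL n k).const_mul (a n)
      have hind : IndepFun S ξ P := by
        have h1 : iIndepFun (fun i ω => a i * ε i ω) P :=
          hindep.comp (fun i x => a i * x) (fun i => by fun_prop)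
        have h2 := h1.indepFun_finsetSum_of_notMem₀
          (fun i => ((hL i 1).1.aemeasurable.const_mul (a i))) (Finset.notMem_range_self (n := n))
        convert h2 using 1
        ext ω; simp [hS]
      have hindp : ∀ j k : ℕ, IndepFun (fun ω => S ω ^ j) (fun ω => ξ ω ^ k) P := fun j k =>
        hind.comp (φ := fun x => x ^ j) (ψ := fun x => x ^ k) (by fun_prop) (by fun_prop)
      have hSi := integrable_pow_of_memLp hSL
      have hξi := integrable_pow_of_memLp hξL
      have hprodi : ∀ j k : ℕ, Integrable (fun ω => S ω ^ j * ξ ω ^ k) P := fun j k =>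
        (hindp j k).integrable_mul (hSi j) (hξi k)
      have hprod : ∀ j k : ℕ, ∫ ω, S ω ^ j * ξ ω ^ k ∂P
          = (∫ ω, S ω ^ j ∂P) * ∫ ω, ξ ω ^ k ∂P := fun j k =>
        (hindp j k).integral_fun_mul_eq_mul_integral (hSi j).1 (hξi k).1
      have hξ0 : ∫ ω, ξ ω ^ 1 ∂P = 0 := by simp [hξ, integral_const_mul, hmean]
      have hξk : ∀ k : ℕ, ∫ ω, ξ ω ^ (2 * k) ∂P ≤ K ^ (2 * k) * ∫ ω, |ε n ω| ^ (2 * k) ∂P := by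
        intro k
        simp only [hξ, mul_pow, integral_const_mul, (even_two_mul k).pow_abs]
        refine mul_le_mul_of_nonneg_right ?_
          (integral_nonneg fun ω => (even_two_mul k).pow_nonneg _)
        rw [← (even_two_mul k).pow_abs (a n)]
        gcongr
      have i1 : Integrable (fun ω => (2 * m + 2) * (S ω ^ (2 * m + 1) * ξ ω ^ 1)) P :=
        (hprodi _ _).const_mul _
      have i2 : Integrable (fun ω => A * (S ω ^ (2 * m) * ξ ω ^ 2)) P := (hprodi _ _).const_mul _
      have i3 : Integrable (fun ω => A * ξ ω ^ (2 * (m + 1))) P := (hξi _).const_mul _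
      have i4 : Integrable (fun ω => S ω ^ (2 * (m + 1))
          + (2 * m + 2) * (S ω ^ (2 * m + 1) * ξ ω ^ 1)) P := (hSi _).add i1
      have i5 : Integrable (fun ω => S ω ^ (2 * (m + 1))
          + (2 * m + 2) * (S ω ^ (2 * m + 1) * ξ ω ^ 1) + A * (S ω ^ (2 * m) * ξ ω ^ 2)) P :=
        i4.add i2
      have hstep : ∫ ω, (S ω + ξ ω) ^ (2 * (m + 1)) ∂P
          ≤ ∫ ω, (S ω ^ (2 * (m + 1)) + (2 * m + 2) * (S ω ^ (2 * m + 1) * ξ ω ^ 1)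
            + A * (S ω ^ (2 * m) * ξ ω ^ 2) + A * ξ ω ^ (2 * (m + 1))) ∂P := by
        refine integral_mono ?_ (i5.add i3) fun ω => by simpa using hineq (S ω) (ξ ω)
        exact integrable_pow_of_memLp (fun k => (hSL k).add (hξL k)) _
      rw [integral_add i5 i3, integral_add i4 i2, integral_add (hSi _) i1, integral_const_mul,
        integral_const_mul, integral_const_mul, hprod, hprod, hξ0] at hstep
      have hSn := ihn a fun i hi => ha i (hi.trans (Nat.lt_succ_self n))
      have hSm := ih n a fun i hi => ha i (hi.trans (Nat.lt_succ_self n))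
      have hξ2 : ∫ ω, ξ ω ^ 2 ∂P ≤ K ^ 2 * M₂ := by
        have := hξk 1
        rw [mul_one] at this
        exact this.trans (by gcongr; exact hM₂ n)
      have hξm : ∫ ω, ξ ω ^ (2 * (m + 1)) ∂P ≤ K ^ (2 * (m + 1)) * M :=
        (hξk (m + 1)).trans (mul_le_mul_of_nonneg_left (hM n) hKe)
      have hn1 : (n : ℝ) ^ m ≤ ((n : ℝ) + 1) ^ m := by gcongr; linarith
      have h1n : (1 : ℝ) ≤ ((n : ℝ) + 1) ^ m := one_le_pow₀ (by linarith [n.cast_nonneg (α := ℝ)])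
      simp only [Finset.sum_range_succ]
      refine hstep.trans ?_
      have t1 : A * ((∫ ω, S ω ^ (2 * m) ∂P) * ∫ ω, ξ ω ^ 2 ∂P)
          ≤ A * (C * (K ^ 2 * M₂)) * ((n : ℝ) + 1) ^ m := by
        calc _ ≤ A * ((C * ((n : ℝ) + 1) ^ m) * (K ^ 2 * M₂)) := by
              refine mul_le_mul_of_nonneg_left (mul_le_mul ?_ hξ2 ?_ ?_) hA
              · exact hSm.trans (by gcongr)
              · exact integral_nonneg fun ω => by positivity
              · positivity
          _ = _ := by ring
      have t2 : A * ∫ ω, ξ ω ^ (2 * (m + 1)) ∂P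
          ≤ A * (K ^ (2 * (m + 1)) * M) * ((n : ℝ) + 1) ^ m := by
        calc _ ≤ A * (K ^ (2 * (m + 1)) * M) := by gcongr
          _ ≤ _ := le_mul_of_one_le_right (by positivity) h1n
      have t3 : C' * (n : ℝ) ^ (m + 1) ≤ C' * (n * ((n : ℝ) + 1) ^ m) := by
        rw [pow_succ']; gcongr
      push_cast
      rw [pow_succ' ((n : ℝ) + 1)]
      have : C' * (((n : ℝ) + 1) * ((n : ℝ) + 1) ^ m) = C' * (n * ((n : ℝ) + 1) ^ m)
          + A * (C * (K ^ 2 * M₂)) * ((n : ℝ) + 1) ^ m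
          + A * (K ^ (2 * (m + 1)) * M) * ((n : ℝ) + 1) ^ m := by rw [hC']; ring
      rw [this]
      simp only [mul_zero, add_zero]
      linarith

end Moments

/-! ### Convergence of integrals of functions of polynomial growth -/

theorem tendsto_integral_of_polynomial_growth {Ω Ω' E : Type*} [MeasurableSpace Ω]
    [MeasurableSpace Ω'] {P : Measure Ω} [IsProbabilityMeasure P] {Q : Measure Ω'}
    [IsProbabilityMeasure Q] [NormedAddCommGroup E] [MeasurableSpace E] [BorelSpace E]
    [SecondCountableTopology E]
    {Y : ℕ → Ω → E} {Z : Ω' → E} (hYZ : TendstoInDistribution Y atTop Z (fun _ => P) Q)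
    (hYi : ∀ n k : ℕ, Integrable (fun ω => (1 + ‖Y n ω‖) ^ k) P)
    (hYb : ∀ k : ℕ, ∃ C : ℝ, ∀ n, ∫ ω, (1 + ‖Y n ω‖) ^ k ∂P ≤ C)
    (hZi : ∀ k : ℕ, Integrable (fun ω => (1 + ‖Z ω‖) ^ k) Q)
    {f : E → ℝ} (hf : Continuous f) {K : ℝ} {q : ℕ} (hK : ∀ x, |f x| ≤ K * (1 + ‖x‖) ^ q) :
    Tendsto (fun n => ∫ ω, f (Y n ω) ∂P) atTop (𝓝 (∫ ω, f (Z ω) ∂Q)) := by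
  have hK0 : 0 ≤ K := by
    have := (abs_nonneg _).trans (hK 0)
    simpa using this
  have hYm := hYZ.forall_aemeasurable
  have hZm := hYZ.aemeasurable_limit
  obtain ⟨C₁, hC₁⟩ := hYb (q + 1)
  set C := max C₁ (∫ ω, (1 + ‖Z ω‖) ^ (q + 1) ∂Q) with hC
  have hC0 : 0 ≤ C := (integral_nonneg fun ω => by positivity).trans (le_max_right _ _)
  have hfY : ∀ n, Integrable (fun ω => f (Y n ω)) P := fun n =>
    ((hYi n q).const_mul K).mono' (hf.measurable.comp_aemeasurable (hYm n)).aestronglyMeasurable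
      (ae_of_all _ fun ω => hK _)
  have hfZ : Integrable (fun ω => f (Z ω)) Q :=
    ((hZi q).const_mul K).mono' (hf.measurable.comp_aemeasurable hZm).aestronglyMeasurable
      (ae_of_all _ fun ω => hK _)
  have main : ∀ M : ℝ, 0 ≤ M → ∃ g : BoundedContinuousFunction E ℝ,
      ∀ x, |f x - g x| ≤ K / (1 + M) * (1 + ‖x‖) ^ (q + 1) := by
    intro M hM
    let χ : E → ℝ := fun x => max 0 (min 1 (M + 1 - ‖x‖))
    have hχc : Continuous χ := by fun_prop
    have hχ0 : ∀ x, 0 ≤ χ x := fun x => le_max_left _ _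
    have hχ1 : ∀ x, χ x ≤ 1 := fun x => max_le zero_le_one (min_le_left _ _)
    refine ⟨BoundedContinuousFunction.ofNormedAddCommGroup (fun x => f x * χ x)
      (hf.mul hχc) (K * (M + 2) ^ q) fun x => ?_, fun x => ?_⟩
    · rw [Real.norm_eq_abs, abs_mul, abs_of_nonneg (hχ0 x)]
      rcases le_or_gt ‖x‖ (M + 1) with h | h
      · calc |f x| * χ x ≤ |f x| * 1 := by gcongr; exact hχ1 x
          _ ≤ K * (1 + ‖x‖) ^ q := by rw [mul_one]; exact hK x
          _ ≤ _ := mul_le_mul_of_nonneg_left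
            (pow_le_pow_left₀ (by positivity) (by linarith) q) hK0
      · have : χ x = 0 := max_eq_left ((min_le_right _ _).trans (by linarith))
        rw [this, mul_zero]; positivity
    · change |f x - f x * χ x| ≤ _
      rcases le_or_gt ‖x‖ M with h | h
      · have : χ x = 1 := by
          simp only [χ]
          rw [min_eq_left (by linarith)]; simp
        rw [this]; simp; positivity
      · rw [show f x - f x * χ x = f x * (1 - χ x) by ring, abs_mul,
          abs_of_nonneg (sub_nonneg.2 (hχ1 x))]
        calc |f x| * (1 - χ x) ≤ |f x| * 1 := by gcongr; linarith [hχ0 x]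
          _ ≤ K * (1 + ‖x‖) ^ q := by rw [mul_one]; exact hK x
          _ ≤ K * (1 + ‖x‖) ^ q * ((1 + ‖x‖) / (1 + M)) := by
            refine le_mul_of_one_le_right (by positivity) ?_
            rw [one_le_div (by positivity)]; linarith
          _ = _ := by rw [pow_succ]; ring
  rw [Metric.tendsto_atTop]
  intro η hη
  set M : ℝ := 4 * (K * C) / η with hM
  have hM0 : 0 ≤ M := by positivity
  obtain ⟨g, hg⟩ := main M hM0
  have hconv := (ProbabilityMeasure.tendsto_iff_forall_integral_tendsto.1 hYZ.tendsto) g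
  simp only [ProbabilityMeasure.coe_mk] at hconv
  rw [integral_map hZm g.continuous.measurable.aestronglyMeasurable] at hconv
  have hconv' : Tendsto (fun n => ∫ ω, g (Y n ω) ∂P) atTop (𝓝 (∫ ω, g (Z ω) ∂Q)) := by
    refine hconv.congr fun n => ?_
    rw [integral_map (hYm n) g.continuous.measurable.aestronglyMeasurable]
  obtain ⟨N, hN⟩ := Metric.tendsto_atTop.1 hconv' (η / 2) (by positivity)
  have hsmall : K / (1 + M) * C < η / 4 := by
    rw [div_mul_eq_mul_div, div_lt_iff₀ (by positivity), hM]
    have : η / 4 * (1 + 4 * (K * C) / η) = η / 4 + K * C := by field_simp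
    rw [this]; linarith
  have hgY : ∀ n, Integrable (fun ω => g (Y n ω)) P := fun n =>
    Integrable.of_bound (g.continuous.measurable.comp_aemeasurable (hYm n)).aestronglyMeasurable
      ‖g‖ (ae_of_all _ fun ω => g.norm_coe_le_norm _)
  have hgZ : Integrable (fun ω => g (Z ω)) Q :=
    Integrable.of_bound (g.continuous.measurable.comp_aemeasurable hZm).aestronglyMeasurable
      ‖g‖ (ae_of_all _ fun ω => g.norm_coe_le_norm _)
  have dY : ∀ n, |∫ ω, f (Y n ω) ∂P - ∫ ω, g (Y n ω) ∂P| ≤ K / (1 + M) * C := by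
    intro n
    rw [← integral_sub (hfY n) (hgY n)]
    calc _ ≤ ∫ ω, |f (Y n ω) - g (Y n ω)| ∂P := abs_integral_le_integral_abs
      _ ≤ ∫ ω, K / (1 + M) * (1 + ‖Y n ω‖) ^ (q + 1) ∂P :=
        integral_mono ((hfY n).sub (hgY n)).abs ((hYi n _).const_mul _) fun ω => hg _
      _ ≤ _ := by
        rw [integral_const_mul]
        gcongr
        exact (hC₁ n).trans (le_max_left _ _)
  have dZ : |∫ ω, f (Z ω) ∂Q - ∫ ω, g (Z ω) ∂Q| ≤ K / (1 + M) * C := by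
    rw [← integral_sub hfZ hgZ]
    calc _ ≤ ∫ ω, |f (Z ω) - g (Z ω)| ∂Q := abs_integral_le_integral_abs
      _ ≤ ∫ ω, K / (1 + M) * (1 + ‖Z ω‖) ^ (q + 1) ∂Q :=
        integral_mono (hfZ.sub hgZ).abs ((hZi _).const_mul _) fun ω => hg _
      _ ≤ _ := by
        rw [integral_const_mul]
        gcongr
        exact le_max_right _ _
  refine ⟨N, fun n hn => ?_⟩
  have h1 := hN n hn
  rw [Real.dist_eq] at h1 ⊢
  have h2 := dY n
  rw [abs_le] at h2 dZ
  rw [abs_lt] at h1 ⊢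
  constructor <;> linarith [h1.1, h1.2, h2.1, h2.2, dZ.1, dZ.2]

/-! ### A central limit theorem for weighted sums -/

theorem norm_prod_sub_prod_le {ι : Type*} (s : Finset ι) (f g : ι → ℂ)
    (hf : ∀ i ∈ s, ‖f i‖ ≤ 1) (hg : ∀ i ∈ s, ‖g i‖ ≤ 1) :
    ‖∏ i ∈ s, f i - ∏ i ∈ s, g i‖ ≤ ∑ i ∈ s, ‖f i - g i‖ := by
  classical
  induction s using Finset.induction with
  | empty => simp
  | insert a s ha ih =>
    rw [Finset.prod_insert ha, Finset.prod_insert ha, Finset.sum_insert ha]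
    have h1 : f a * ∏ i ∈ s, f i - g a * ∏ i ∈ s, g i
        = (f a - g a) * ∏ i ∈ s, f i + g a * (∏ i ∈ s, f i - ∏ i ∈ s, g i) := by ring
    have h2 : ‖∏ i ∈ s, f i‖ ≤ 1 := by
      rw [norm_prod]
      exact Finset.prod_le_one (fun _ _ => norm_nonneg _)
        fun i hi => hf i (Finset.mem_insert_of_mem hi)
    rw [h1]
    refine (norm_add_le _ _).trans (add_le_add ?_ ?_)
    · rw [norm_mul]; exact mul_le_of_le_one_right (norm_nonneg _) h2
    · rw [norm_mul]
      exact (mul_le_of_le_one_left (norm_nonneg _) (hg a (Finset.mem_insert_self _ _))).trans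
        (ih (fun i hi => hf i (Finset.mem_insert_of_mem hi))
          fun i hi => hg i (Finset.mem_insert_of_mem hi))

theorem charFun_sub_exp_isLittleO {Ω : Type*} [MeasurableSpace Ω] {P : Measure Ω}
    [IsProbabilityMeasure P] {Y : Ω → ℝ} (hY : MemLp Y 2 P) (h0 : ∫ ω, Y ω ∂P = 0) :
    (fun t : ℝ => charFun (P.map Y) t - Complex.exp (-((∫ ω, Y ω ^ 2 ∂P : ℝ) * t ^ 2 / 2)))
      =o[𝓝 0] fun t : ℝ => t ^ 2 := by
  have hYm : AEMeasurable Y P := hY.1.aemeasurable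
  have hint : MemLp id 2 (P.map Y) := by
    rw [memLp_map_measure_iff (by fun_prop) hYm]; exact hY
  have : IsProbabilityMeasure (P.map Y) := Measure.isProbabilityMeasure_map hYm
  have h1 : (fun t : ℝ => charFun (P.map Y) t
      - (1 - ((∫ ω, Y ω ^ 2 ∂P : ℝ) : ℂ) * t ^ 2 / 2)) =o[𝓝 0] fun t : ℝ => t ^ 2 := by
    have h := taylor_isLittleO_univ (f := charFun (P.map Y)) (n := 2) (x₀ := 0)
      (contDiff_charFun hint)
    simp only [sub_zero] at h
    refine h.congr_left fun t => ?_
    rw [taylorWithinEval_charFun_two_zero hYm hint, h0]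
    simp
  have h2 : (fun t : ℝ => (1 - ((∫ ω, Y ω ^ 2 ∂P : ℝ) : ℂ) * t ^ 2 / 2)
      - Complex.exp (-((∫ ω, Y ω ^ 2 ∂P : ℝ) * t ^ 2 / 2))) =o[𝓝 0] fun t : ℝ => t ^ 2 := by
    set s : ℝ := ∫ ω, Y ω ^ 2 ∂P
    have h3 : (fun z : ℂ => Complex.exp z - (1 + z)) =o[𝓝 0] fun z : ℂ => z := by
      have := (Complex.hasDerivAt_exp 0).isLittleO
      refine (this.congr (fun z => ?_) fun z => by simp)
      simp; ring
    have h4 : Tendsto (fun t : ℝ => -((s : ℂ) * (t : ℂ) ^ 2 / 2)) (𝓝 0) (𝓝 0) := by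
      have : Continuous fun t : ℝ => -((s : ℂ) * (t : ℂ) ^ 2 / 2) := by fun_prop
      simpa using this.tendsto 0
    have h5 := (h3.comp_tendsto h4).neg_left
    refine (h5.trans_isBigO ?_).congr_left fun t => ?_
    · refine Asymptotics.IsBigO.of_bound (|s| / 2) (Eventually.of_forall fun t => ?_)
      simp only [Function.comp_apply, norm_neg, norm_div, norm_mul, norm_pow, Complex.norm_real,
        Real.norm_eq_abs, Complex.norm_ofNat]
      apply le_of_eq; ring
    · simp only [Function.comp_apply]; ring
  exact (h1.add h2).congr_left fun t => by ring

theorem tendsto_prod_charFun {μ : Measure ℝ} [IsProbabilityMeasure μ] {v : ℝ} (hv : 0 ≤ v)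
    (hμ : (fun t : ℝ => charFun μ t - Complex.exp (-(v * t ^ 2 / 2))) =o[𝓝 0] fun t : ℝ => t ^ 2)
    {a : ℕ → ℕ → ℝ} {b : ℕ → ℝ} (hb : Tendsto b atTop (𝓝 0))
    (hab : ∀ᶠ n in atTop, ∀ i < n, |a n i| ≤ b n) {s : ℝ}
    (hs : Tendsto (fun n => ∑ i ∈ Finset.range n, a n i ^ 2) atTop (𝓝 s)) :
    Tendsto (fun n => ∏ i ∈ Finset.range n, charFun μ (a n i)) atTop
      (𝓝 (Complex.exp (-(v * s / 2)))) := by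
  have h1 : Tendsto (fun n => ∏ i ∈ Finset.range n, Complex.exp (-(v * (a n i) ^ 2 / 2))) atTop
      (𝓝 (Complex.exp (-(v * s / 2)))) := by
    have hc : Continuous fun r : ℝ => Complex.exp (-((v : ℂ) * r / 2)) := by fun_prop
    refine ((hc.tendsto s).comp hs).congr fun n => ?_
    rw [← Complex.exp_sum]
    simp [Finset.mul_sum, Finset.sum_div]
  rw [tendsto_iff_norm_sub_tendsto_zero]
  have h2 : Tendsto (fun n => ‖(∏ i ∈ Finset.range n, charFun μ (a n i))
      - ∏ i ∈ Finset.range n, Complex.exp (-(v * (a n i) ^ 2 / 2))‖) atTop (𝓝 0) := by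
    rw [Metric.tendsto_atTop]
    intro η hη
    have hs0 : 0 ≤ s := ge_of_tendsto' hs fun n => Finset.sum_nonneg fun i _ => sq_nonneg _
    have hη' : 0 < η / (s + 2) := by positivity
    obtain ⟨δ, hδ, hδ'⟩ := Metric.eventually_nhds_iff.1 (hμ.def hη')
    have hsum : ∀ᶠ n in atTop, ∑ i ∈ Finset.range n, a n i ^ 2 < s + 1 :=
      hs.eventually_lt_const (by linarith)
    have hbδ : ∀ᶠ n in atTop, b n < δ := hb.eventually_lt_const hδ
    obtain ⟨N, hN⟩ := eventually_atTop.1 (hsum.and (hbδ.and hab))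
    refine ⟨N, fun n hn => ?_⟩
    obtain ⟨hn1, hn2, hn3⟩ := hN n hn
    rw [Real.dist_eq, sub_zero, abs_of_nonneg (norm_nonneg _)]
    calc _ ≤ ∑ i ∈ Finset.range n, ‖charFun μ (a n i) - Complex.exp (-(v * (a n i) ^ 2 / 2))‖ := by
          refine norm_prod_sub_prod_le _ _ _ (fun i _ => norm_charFun_le_one _) fun i _ => ?_
          rw [Complex.norm_exp]
          refine Real.exp_le_one_iff.2 ?_
          have : (-((v : ℂ) * (a n i) ^ 2 / 2)).re = -(v * (a n i) ^ 2 / 2) := by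
            rw [← Complex.ofReal_re (-(v * (a n i) ^ 2 / 2))]; push_cast; rfl
          rw [this]
          have : 0 ≤ v * (a n i) ^ 2 / 2 := by positivity
          linarith
      _ ≤ ∑ i ∈ Finset.range n, η / (s + 2) * (a n i) ^ 2 := by
          refine Finset.sum_le_sum fun i hi => ?_
          have := hδ' (y := a n i) (by
            rw [Real.dist_eq, sub_zero]
            exact (hn3 i (Finset.mem_range.1 hi)).trans_lt hn2)
          simpa using this
      _ = η / (s + 2) * ∑ i ∈ Finset.range n, (a n i) ^ 2 := by rw [Finset.mul_sum]
      _ ≤ η / (s + 2) * (s + 1) := by gcongr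
      _ < η := by rw [div_mul_eq_mul_div, div_lt_iff₀ (by positivity)]; nlinarith
  have h3 := h2.add (tendsto_iff_norm_sub_tendsto_zero.1 h1)
  rw [add_zero] at h3
  refine squeeze_zero (fun _ => norm_nonneg _) (fun n => ?_) h3
  exact norm_sub_le_norm_sub_add_norm_sub _ _ _

theorem tendstoInDistribution_weighted_sum {Ω : Type*} [MeasurableSpace Ω] {P : Measure Ω}
    [IsProbabilityMeasure P] {ε : ℕ → Ω → ℝ} (hindep : iIndepFun ε P)
    (hident : ∀ i, IdentDistrib (ε i) (ε 0) P P) (hmean : ∫ ω, ε 0 ω ∂P = 0)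
    (hL : MemLp (ε 0) 2 P) {p : ℕ} {x : ℕ → ℕ → EuclideanSpace ℝ (Fin p)} {K : ℝ}
    (hx : ∀ n : ℕ, 0 < n → ∀ i < n, ‖x n i‖ ≤ K) {S : Matrix (Fin p) (Fin p) ℝ}
    (hS : S.PosSemidef)
    (hlim : ∀ t : EuclideanSpace ℝ (Fin p),
      Tendsto (fun n : ℕ => (n : ℝ)⁻¹ * ∑ i ∈ Finset.range n, inner ℝ (x n i) t ^ 2) atTop
        (𝓝 (t.ofLp ⬝ᵥ S.mulVec t.ofLp))) :
    TendstoInDistribution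
      (fun (n : ℕ) ω => (√(n : ℝ))⁻¹ • ∑ i ∈ Finset.range n, ε i ω • x n i) atTop
      (id : EuclideanSpace ℝ (Fin p) → _) (fun _ => P)
      (multivariateGaussian 0 ((∫ ω, ε 0 ω ^ 2 ∂P) • S)) where
  forall_aemeasurable n := by
    have h : AEMeasurable (fun ω => ∑ i ∈ Finset.range n, ε i ω • x n i) P :=
      Finset.aemeasurable_fun_sum _ fun i _ => (hident i).aemeasurable_fst.smul_const _
    exact h.const_smul (√(n : ℝ))⁻¹
  tendsto := by
    have hεm := fun i => (hident i).aemeasurable_fst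
    have hv : 0 ≤ ∫ ω, ε 0 ω ^ 2 ∂P := integral_nonneg fun ω => sq_nonneg _
    refine ProbabilityMeasure.tendsto_iff_tendsto_charFun.2 fun t => ?_
    simp only [ProbabilityMeasure.coe_mk, Measure.map_id]
    rw [charFun_multivariateGaussian (hS.smul hv)]
    have : IsProbabilityMeasure (P.map (ε 0)) := Measure.isProbabilityMeasure_map (hεm 0)
    have key := tendsto_prod_charFun hv (charFun_sub_exp_isLittleO hL hmean)
      (a := fun n i => (√(n : ℝ))⁻¹ * inner ℝ (x n i) t)
      (b := fun n => (√(n : ℝ))⁻¹ * (K * ‖t‖)) (s := t.ofLp ⬝ᵥ S.mulVec t.ofLp) ?_ ?_ ?_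
    · refine (key.congr fun n => ?_).trans (le_of_eq ?_)
      · have hmap : ∀ i, charFun (P.map (fun ω => ((√(n : ℝ))⁻¹ * ε i ω) • x n i)) t
            = charFun (P.map (ε 0)) ((√(n : ℝ))⁻¹ * inner ℝ (x n i) t) := by
          intro i
          rw [← (hident i).map_eq, charFun_apply, charFun_apply,
            integral_map (((hεm i).const_mul _).smul_const _) (by fun_prop),
            integral_map (hεm i) (by fun_prop)]
          refine integral_congr_ae (ae_of_all _ fun ω => ?_)
          simp only [real_inner_smul_left, RCLike.inner_apply, conj_trivial]
          congr 3
          ring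
        rw [← Finset.prod_congr rfl fun i _ => hmap i]
        have hind : iIndepFun (fun i ω => ((√(n : ℝ))⁻¹ * ε i ω) • x n i) P :=
          hindep.comp (fun i e => ((√(n : ℝ))⁻¹ * e) • x n i) fun i => by fun_prop
        have := (hind.restrict (Finset.range n)).charFun_map_fun_finsetSum_eq_prod
          (fun i _ => ((hεm i).const_mul _).smul_const _)
        rw [← Finset.prod_apply, ← this]
        congr 2
        ext ω
        simp [Finset.smul_sum, mul_smul]
      · congr 2
        simp [Matrix.smul_mulVec]
    · have h1 : Tendsto (fun n : ℕ => (√(n : ℝ))⁻¹) atTop (𝓝 0) :=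
        tendsto_inv_atTop_zero.comp (Real.tendsto_sqrt_atTop.comp tendsto_natCast_atTop_atTop)
      simpa using h1.mul_const (K * ‖t‖)
    · filter_upwards [eventually_gt_atTop 0] with n hn i hi
      rw [abs_mul, abs_of_nonneg (by positivity : (0 : ℝ) ≤ (√(n : ℝ))⁻¹)]
      gcongr
      exact (abs_real_inner_le_norm _ _).trans (by gcongr; exact hx n hn i hi)
    · refine (hlim t).congr fun n => ?_
      simp only [mul_pow, inv_pow, Real.sq_sqrt (Nat.cast_nonneg n), Finset.mul_sum]

/-! ### Elementary inequalities for the bridge penalty -/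

theorem abs_rpow_sub_abs_rpow_le {γ : ℝ} (hγ₀ : 0 < γ) (hγ₁ : γ < 1) {a : ℝ} (ha : a ≠ 0) (b : ℝ) :
    |a| ^ γ - |b| ^ γ ≤ |a| ^ (γ - 1) * |b - a| := by
  have ha' : 0 < |a| := abs_pos.2 ha
  have hpos : 0 ≤ |a| ^ (γ - 1) := by positivity
  rcases le_or_gt |a| |b| with h | h
  · have := Real.rpow_le_rpow ha'.le h hγ₀.le
    have : 0 ≤ |a| ^ (γ - 1) * |b - a| := by positivity
    linarith
  · have e1 : |a| ^ γ = |a| * |a| ^ (γ - 1) := by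
      rw [← Real.rpow_one_add' ha'.le (by linarith)]; congr 1; ring
    have e2 : |b| * |a| ^ (γ - 1) ≤ |b| ^ γ := by
      rcases eq_or_ne b 0 with rfl | hb
      · simp [Real.zero_rpow hγ₀.ne']
      · have hb' : 0 < |b| := abs_pos.2 hb
        have e3 : |b| ^ γ = |b| * |b| ^ (γ - 1) := by
          rw [← Real.rpow_one_add' hb'.le (by linarith)]; congr 1; ring
        rw [e3]
        exact mul_le_mul_of_nonneg_left
          (Real.rpow_le_rpow_of_nonpos hb' h.le (by linarith)) hb'.le
    have h3 : |a| - |b| ≤ |b - a| := by rw [abs_sub_comm]; exact abs_sub_abs_le_abs_sub a b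
    nlinarith

theorem abs_one_add_rpow_sub_le {γ : ℝ} (hγ₀ : 0 < γ) (hγ₁ : γ < 1) (t : ℝ) :
    |(|1 + t| ^ γ - 1 - γ * t)| ≤ 2 * t ^ 2 := by
  rcases le_or_gt (-1) t with ht | ht
  · rw [abs_of_nonneg (by linarith : 0 ≤ 1 + t)]
    have h1 := rpow_one_add_le_one_add_mul_self ht hγ₀.le hγ₁.le
    have h2 := rpow_one_add_le_one_add_mul_self ht (by linarith : 0 ≤ 1 - γ) (by linarith)
    have hden : γ ≤ 1 + (1 - γ) * t := by nlinarith
    have h3 : (1 + t) ^ γ * (1 + (1 - γ) * t) ≥ 1 + t := by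
      calc 1 + t = (1 + t) ^ (γ + (1 - γ)) := by simp
        _ = (1 + t) ^ γ * (1 + t) ^ (1 - γ) :=
          Real.rpow_add' (by linarith) (by norm_num)
        _ ≤ _ := mul_le_mul_of_nonneg_left h2 (Real.rpow_nonneg (by linarith) _)
    rw [abs_le]
    constructor
    · by_contra! hcon
      have : (1 + t) ^ γ * (1 + (1 - γ) * t) < (1 + γ * t - 2 * t ^ 2) * (1 + (1 - γ) * t) := by
        have : 0 < 1 + (1 - γ) * t := by linarith
        gcongr; linarith
      have h4 : γ * t ^ 2 ≤ t ^ 2 * (1 + (1 - γ) * t) := by nlinarith [sq_nonneg t]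
      have h5 : γ * (1 - γ) * t ^ 2 ≤ γ * t ^ 2 := by nlinarith [sq_nonneg t, mul_pos hγ₀ hγ₀]
      nlinarith [sq_nonneg t]
    · nlinarith [sq_nonneg t]
  · have h0 : 0 ≤ |1 + t| ^ γ := by positivity
    have h1 : |1 + t| ^ γ ≤ 1 + γ * (-2 - t) := by
      have : |1 + t| = 1 + (-2 - t) := by rw [abs_of_nonpos (by linarith)]; ring
      rw [this]
      exact rpow_one_add_le_one_add_mul_self (by linarith) hγ₀.le hγ₁.le
    rw [abs_le]
    constructor <;> nlinarith

theorem abs_abs_add_rpow_sub_le {γ : ℝ} (hγ₀ : 0 < γ) (hγ₁ : γ < 1) {a : ℝ} (ha : a ≠ 0) (h : ℝ) :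
    |(|a + h| ^ γ - |a| ^ γ - γ * (Real.sign a * |a| ^ (γ - 1)) * h)|
      ≤ 2 * |a| ^ γ / a ^ 2 * h ^ 2 := by
  have ha' : 0 < |a| := abs_pos.2 ha
  have e1 : Real.sign a * |a| ^ (γ - 1) = |a| ^ γ / a := by
    rw [Real.rpow_sub_one ha'.ne']
    rcases lt_or_gt_of_ne ha with h | h
    · rw [Real.sign_of_neg h, abs_of_neg h]; field_simp
    · rw [Real.sign_of_pos h, abs_of_pos h]; field_simp
  have e2 : |a + h| ^ γ = |a| ^ γ * |1 + h / a| ^ γ := by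
    rw [← Real.mul_rpow ha'.le (abs_nonneg _), ← abs_mul]
    congr 2
    field_simp
  have e3 : |a + h| ^ γ - |a| ^ γ - γ * (Real.sign a * |a| ^ (γ - 1)) * h
      = |a| ^ γ * (|1 + h / a| ^ γ - 1 - γ * (h / a)) := by
    rw [e1, e2]; ring
  rw [e3, abs_mul, abs_of_nonneg (by positivity : 0 ≤ |a| ^ γ)]
  refine (mul_le_mul_of_nonneg_left (abs_one_add_rpow_sub_le hγ₀ hγ₁ _)
    (by positivity)).trans (le_of_eq ?_)
  ring

theorem mul_sum_abs_rpow_sub_le {γ : ℝ} (hγ₀ : 0 < γ) (hγ₁ : γ < 1) {p : ℕ}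
    {ρ₀ : EuclideanSpace ℝ (Fin p)} (hρ₀ : ∀ l, ρ₀ l ≠ 0) {lam s : ℝ} (hlam : 0 ≤ lam) (hs : 0 < s)
    (v : EuclideanSpace ℝ (Fin p)) :
    -(lam * ∑ l, (|ρ₀ l + v l / s| ^ γ - |ρ₀ l| ^ γ))
      ≤ lam / s * (∑ l, |ρ₀ l| ^ (γ - 1)) * ‖v‖ := by
  rw [← mul_neg, ← Finset.sum_neg_distrib]
  calc _ ≤ lam * ∑ l, |ρ₀ l| ^ (γ - 1) * (‖v‖ / s) := by
        refine mul_le_mul_of_nonneg_left (Finset.sum_le_sum fun l _ => ?_) hlam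
        rw [neg_sub]
        refine (abs_rpow_sub_abs_rpow_le hγ₀ hγ₁ (hρ₀ l) _).trans ?_
        refine mul_le_mul_of_nonneg_left ?_ (by positivity)
        rw [add_sub_cancel_left, abs_div, abs_of_pos hs]
        gcongr
        exact PiLp.norm_apply_le v l
    _ = _ := by rw [← Finset.sum_mul]; ring

theorem abs_penalty_sub_linear_le {γ : ℝ} (hγ₀ : 0 < γ) (hγ₁ : γ < 1) {p : ℕ}
    {ρ₀ : EuclideanSpace ℝ (Fin p)} (hρ₀ : ∀ l, ρ₀ l ≠ 0) {lam s : ℝ} (hlam : 0 ≤ lam) (hs : 0 < s)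
    (lam₀ : ℝ) (v : EuclideanSpace ℝ (Fin p)) :
    |lam * ∑ l, (|ρ₀ l + v l / s| ^ γ - |ρ₀ l| ^ γ) - 2 * lam₀ * ∑ l, upsilon γ ρ₀ l * v l|
      ≤ |lam / s - lam₀| * (2 * ∑ l, |upsilon γ ρ₀ l|) * ‖v‖
        + lam / s / s * (∑ l, 2 * |ρ₀ l| ^ γ / ρ₀ l ^ 2) * ‖v‖ ^ 2 := by
  have hv : ∀ l, |v l| ≤ ‖v‖ := fun l => PiLp.norm_apply_le v l
  have e : lam * ∑ l, (|ρ₀ l + v l / s| ^ γ - |ρ₀ l| ^ γ) - 2 * lam₀ * ∑ l, upsilon γ ρ₀ l * v l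
      = (lam / s - lam₀) * (2 * ∑ l, upsilon γ ρ₀ l * v l)
        + lam * ∑ l, (|ρ₀ l + v l / s| ^ γ - |ρ₀ l| ^ γ
            - γ * (Real.sign (ρ₀ l) * |ρ₀ l| ^ (γ - 1)) * (v l / s)) := by
    have : ∑ l, γ * (Real.sign (ρ₀ l) * |ρ₀ l| ^ (γ - 1)) * (v l / s)
        = 2 / s * ∑ l, upsilon γ ρ₀ l * v l := by
      rw [Finset.mul_sum]
      refine Finset.sum_congr rfl fun l _ => ?_
      simp only [upsilon]; ring
    rw [Finset.sum_sub_distrib (g := fun l => γ * (Real.sign (ρ₀ l) * |ρ₀ l| ^ (γ - 1)) * (v l / s)),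
      this]
    ring
  rw [e]
  refine (abs_add_le _ _).trans (add_le_add ?_ ?_)
  · rw [abs_mul, abs_mul, abs_two, mul_assoc, mul_assoc]
    gcongr
    rw [Finset.sum_mul]
    refine (Finset.abs_sum_le_sum_abs _ _).trans (Finset.sum_le_sum fun l _ => ?_)
    rw [abs_mul]
    gcongr
    exact hv l
  · rw [abs_mul, abs_of_nonneg hlam]
    calc _ ≤ lam * ∑ l, 2 * |ρ₀ l| ^ γ / ρ₀ l ^ 2 * (‖v‖ / s) ^ 2 := by
          refine mul_le_mul_of_nonneg_left ?_ hlam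
          refine (Finset.abs_sum_le_sum_abs _ _).trans (Finset.sum_le_sum fun l _ => ?_)
          refine (abs_abs_add_rpow_sub_le hγ₀ hγ₁ (hρ₀ l) _).trans ?_
          refine mul_le_mul_of_nonneg_left ?_ (by positivity)
          rw [← sq_abs (v l / s), abs_div, abs_of_pos hs]
          gcongr
          exact hv l
      _ = _ := by rw [← Finset.sum_mul]; ring

/-! ### Bilinear forms given by matrices -/

/-- The bilinear form `(a, b) ↦ aᵀ A b`. -/
noncomputable def matForm {m k : ℕ} (A : Matrix (Fin m) (Fin k) ℝ) (a : EuclideanSpace ℝ (Fin m))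
    (b : EuclideanSpace ℝ (Fin k)) : ℝ :=
  a.ofLp ⬝ᵥ A.mulVec b.ofLp

theorem matForm_eq_sum {m k : ℕ} (A : Matrix (Fin m) (Fin k) ℝ) (a : EuclideanSpace ℝ (Fin m))
    (b : EuclideanSpace ℝ (Fin k)) : matForm A a b = ∑ i, ∑ j, A i j * (a i * b j) := by
  simp only [matForm, dotProduct, Matrix.mulVec, Finset.mul_sum]
  exact Finset.sum_congr rfl fun i _ => Finset.sum_congr rfl fun j _ => by ring

theorem matForm_sub {m k : ℕ} (A B : Matrix (Fin m) (Fin k) ℝ) (a : EuclideanSpace ℝ (Fin m))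
    (b : EuclideanSpace ℝ (Fin k)) : matForm (A - B) a b = matForm A a b - matForm B a b := by
  simp [matForm, Matrix.sub_mulVec]

theorem frobNorm_nonneg {m k : ℕ} (A : Matrix (Fin m) (Fin k) ℝ) : 0 ≤ frobNorm A :=
  Real.sqrt_nonneg _

theorem frobNorm_sq {m k : ℕ} (A : Matrix (Fin m) (Fin k) ℝ) :
    frobNorm A ^ 2 = ∑ i, ∑ j, A i j ^ 2 :=
  Real.sq_sqrt (Finset.sum_nonneg fun i _ => Finset.sum_nonneg fun j _ => sq_nonneg (A i j))

theorem continuous_frobNorm {m k : ℕ} :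
    Continuous (frobNorm : Matrix (Fin m) (Fin k) ℝ → ℝ) := by
  unfold frobNorm; fun_prop

theorem abs_matForm_le {m k : ℕ} (A : Matrix (Fin m) (Fin k) ℝ) (a : EuclideanSpace ℝ (Fin m))
    (b : EuclideanSpace ℝ (Fin k)) : |matForm A a b| ≤ frobNorm A * (‖a‖ * ‖b‖) := by
  have h := Finset.sum_mul_sq_le_sq_mul_sq (Finset.univ : Finset (Fin m × Fin k))
    (fun q => A q.1 q.2) (fun q => a q.1 * b q.2)
  simp only [Fintype.sum_prod_type, mul_pow] at h
  rw [← matForm_eq_sum, ← Finset.sum_mul_sum, ← EuclideanSpace.real_norm_sq_eq,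
    ← EuclideanSpace.real_norm_sq_eq] at h
  have h0 : 0 ≤ frobNorm A * (‖a‖ * ‖b‖) := mul_nonneg (frobNorm_nonneg A) (by positivity)
  refine abs_le_of_sq_le_sq (h.trans (le_of_eq ?_)) h0
  rw [mul_pow, mul_pow, frobNorm_sq]

theorem exists_mul_sq_norm_le_matForm {m : ℕ} {A : Matrix (Fin m) (Fin m) ℝ} (hA : A.PosDef) :
    ∃ c : ℝ, 0 < c ∧ ∀ a : EuclideanSpace ℝ (Fin m), c * ‖a‖ ^ 2 ≤ matForm A a a := by
  have hcont : Continuous fun a : EuclideanSpace ℝ (Fin m) => matForm A a a := by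
    simp only [matForm_eq_sum]; fun_prop
  have hpos : ∀ a : EuclideanSpace ℝ (Fin m), a ≠ 0 → 0 < matForm A a a := fun a ha => by
    have := hA.dotProduct_mulVec_pos (x := a.ofLp) (by simpa using ha)
    simpa [matForm] using this
  rcases (Metric.sphere (0 : EuclideanSpace ℝ (Fin m)) 1).eq_empty_or_nonempty with hS | hS
  · refine ⟨1, one_pos, fun a => ?_⟩
    have : a = 0 := by
      by_contra ha
      have : ‖a‖⁻¹ • a ∈ Metric.sphere (0 : EuclideanSpace ℝ (Fin m)) 1 := by
        simp [norm_smul, ha]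
      rw [hS] at this
      exact this
    subst this
    simp [matForm]
  · obtain ⟨a₀, ha₀, hmin⟩ := (isCompact_sphere _ _).exists_isMinOn hS hcont.continuousOn
    have ha₀' : a₀ ≠ 0 := by rintro rfl; simp at ha₀
    refine ⟨matForm A a₀ a₀, hpos a₀ ha₀', fun a => ?_⟩
    rcases eq_or_ne a 0 with rfl | ha
    · simp [matForm]
    · have hmem : ‖a‖⁻¹ • a ∈ Metric.sphere (0 : EuclideanSpace ℝ (Fin m)) 1 := by
        simp [norm_smul, ha]
      have h1 := hmin hmem
      have h2 : matForm A (‖a‖⁻¹ • a) (‖a‖⁻¹ • a) = (‖a‖ ^ 2)⁻¹ * matForm A a a := by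
        simp [matForm, Matrix.mulVec_smul]; ring
      have ha' : 0 < ‖a‖ ^ 2 := by positivity
      simp only [Set.mem_ofPred_eq, h2] at h1
      rw [inv_mul_eq_div, le_div_iff₀ ha'] at h1
      exact h1

theorem matForm_gramZ {p₀ p₁ : ℕ} (n : ℕ) (x : ℕ → Vec p₀ p₁) (a : EuclideanSpace ℝ (Fin p₀)) :
    matForm (gramZ n x) a a = (n : ℝ)⁻¹ * ∑ i ∈ Finset.range n, inner ℝ (x i).1 a ^ 2 := by
  have : gramZ n x = (n : ℝ)⁻¹ • ∑ i ∈ Finset.range n,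
      Matrix.vecMulVec (x i).1.ofLp (x i).1.ofLp := by
    ext k l
    simp [gramZ, gram, Matrix.toBlocks₁₁, Matrix.sum_apply, Matrix.vecMulVec_apply]
  rw [this, matForm, Matrix.smul_mulVec, Matrix.sum_mulVec, dotProduct_smul, dotProduct_sum,
    smul_eq_mul]
  congr 1
  refine Finset.sum_congr rfl fun i _ => ?_
  rw [Matrix.vecMulVec_mulVec, dotProduct_smul]
  simp [EuclideanSpace.inner_eq_star_dotProduct, dotProduct_comm, sq]

theorem matForm_gramRho {p₀ p₁ : ℕ} (n : ℕ) (x : ℕ → Vec p₀ p₁) (a : EuclideanSpace ℝ (Fin p₁)) :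
    matForm (gramRho n x) a a = (n : ℝ)⁻¹ * ∑ i ∈ Finset.range n, inner ℝ (x i).2 a ^ 2 := by
  have : gramRho n x = (n : ℝ)⁻¹ • ∑ i ∈ Finset.range n,
      Matrix.vecMulVec (x i).2.ofLp (x i).2.ofLp := by
    ext k l
    simp [gramRho, gram, Matrix.toBlocks₂₂, Matrix.sum_apply, Matrix.vecMulVec_apply]
  rw [this, matForm, Matrix.smul_mulVec, Matrix.sum_mulVec, dotProduct_smul, dotProduct_sum,
    smul_eq_mul]
  congr 1
  refine Finset.sum_congr rfl fun i _ => ?_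
  rw [Matrix.vecMulVec_mulVec, dotProduct_smul]
  simp [EuclideanSpace.inner_eq_star_dotProduct, dotProduct_comm, sq]

theorem matForm_cross {p₀ p₁ : ℕ} (n : ℕ) (x : ℕ → Vec p₀ p₁) (a : EuclideanSpace ℝ (Fin p₀))
    (b : EuclideanSpace ℝ (Fin p₁)) :
    matForm (cross n x) a b
      = (√(n : ℝ))⁻¹ * ∑ i ∈ Finset.range n, inner ℝ (x i).1 a * inner ℝ (x i).2 b := by
  rw [cross, matForm, Matrix.smul_mulVec, Matrix.sum_mulVec, dotProduct_smul, dotProduct_sum,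
    smul_eq_mul]
  congr 1
  refine Finset.sum_congr rfl fun i _ => ?_
  rw [Matrix.vecMulVec_mulVec, dotProduct_smul]
  simp [EuclideanSpace.inner_eq_star_dotProduct, dotProduct_comm]

theorem matForm_sub_sub_of_isSymm {m : ℕ} {A : Matrix (Fin m) (Fin m) ℝ} (hA : A.IsSymm)
    (a b : EuclideanSpace ℝ (Fin m)) :
    matForm A (a - b) (a - b) = matForm A a a - 2 * matForm A a b + matForm A b b := by
  have h : matForm A b a = matForm A a b := by
    simp only [matForm]
    rw [Matrix.dotProduct_mulVec, ← Matrix.mulVec_transpose, hA.eq, dotProduct_comm]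
  have e : matForm A (a - b) (a - b)
      = matForm A a a - matForm A a b - (matForm A b a - matForm A b b) := by
    simp only [matForm, WithLp.ofLp_sub, Matrix.mulVec_sub, sub_dotProduct, dotProduct_sub]
    ring
  rw [e, h]; ring

/-! ### The rescaled criterion -/

section Criterion

variable {p₀ p₁ : ℕ}

/-- The score `n^{-1/2} ∑_{i<n} e_i x_i`. -/
noncomputable def score (n : ℕ) (x : ℕ → Vec p₀ p₁) (e : ℕ → ℝ) : Vec p₀ p₁ :=
  (√(n : ℝ))⁻¹ • ∑ i ∈ Finset.range n, e i • x i

/-- The bridge contrast as a function of the rescaled estimation error, up to a constant. Here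
`D`, `B` and `s⁻¹ G` are the blocks of the Gram matrix, `W` is the score and `s` the scale. -/
noncomputable def criterion (D : Matrix (Fin p₀) (Fin p₀) ℝ) (G : Matrix (Fin p₀) (Fin p₁) ℝ)
    (B : Matrix (Fin p₁) (Fin p₁) ℝ) (W : Vec p₀ p₁) (s lam γ : ℝ)
    (ρ₀ : EuclideanSpace ℝ (Fin p₁)) (u : Vec p₀ p₁) : ℝ :=
  matForm D u.1 u.1 + 2 / s * matForm G u.1 u.2 + matForm B u.2 u.2
    - 2 * (inner ℝ W.1 u.1 + inner ℝ W.2 u.2) + lam * ∑ k, |u.1 k / s| ^ γ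
    + lam * ∑ l, (|ρ₀ l + u.2 l / s| ^ γ - |ρ₀ l| ^ γ)

theorem dot_eq_inner (θ x : Vec p₀ p₁) : dot θ x = inner ℝ x.1 θ.1 + inner ℝ x.2 θ.2 := by
  simp [dot, PiLp.inner_apply]

theorem inner_score_fst (n : ℕ) (x : ℕ → Vec p₀ p₁) (e : ℕ → ℝ) (a : EuclideanSpace ℝ (Fin p₀)) :
    inner ℝ (score n x e).1 a
      = (√(n : ℝ))⁻¹ * ∑ i ∈ Finset.range n, e i * inner ℝ (x i).1 a := by
  simp [score, real_inner_smul_left, sum_inner, Prod.fst_sum]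

theorem inner_score_snd (n : ℕ) (x : ℕ → Vec p₀ p₁) (e : ℕ → ℝ) (a : EuclideanSpace ℝ (Fin p₁)) :
    inner ℝ (score n x e).2 a
      = (√(n : ℝ))⁻¹ * ∑ i ∈ Finset.range n, e i * inner ℝ (x i).2 a := by
  simp [score, real_inner_smul_left, sum_inner, Prod.snd_sum]

theorem contrast_eq_criterion {n : ℕ} (hn : 0 < n) (x : ℕ → Vec p₀ p₁) (e : ℕ → ℝ) (lam γ : ℝ)
    (ρ₀ : EuclideanSpace ℝ (Fin p₁)) (θ : Vec p₀ p₁) :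
    contrast n x (fun i => dot (0, ρ₀) (x i) + e i) lam γ θ
      = (∑ i ∈ Finset.range n, e i ^ 2 + lam * ∑ l, |ρ₀ l| ^ γ)
        + criterion (gramZ n x) (cross n x) (gramRho n x) (score n x e) (√(n : ℝ)) lam γ ρ₀
          (scaledError ρ₀ n θ) := by
  set s := √(n : ℝ) with hs
  have hs0 : s ≠ 0 := by positivity
  have hss : (n : ℝ)⁻¹ = s⁻¹ ^ 2 := by rw [inv_pow, hs, Real.sq_sqrt n.cast_nonneg]
  set u := scaledError ρ₀ n θ with hu
  have h1 : ∀ k, u.1 k / s = θ.1 k := fun k => by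
    simp [hu, scaledError, ← hs]; field_simp
  have h2 : ∀ l, ρ₀ l + u.2 l / s = θ.2 l := fun l => by
    simp [hu, scaledError, ← hs]; field_simp; ring
  have h3 : ∀ i, dot (0, ρ₀) (x i) + e i - dot θ (x i)
      = e i - s⁻¹ * (inner ℝ (x i).1 u.1 + inner ℝ (x i).2 u.2) := fun i => by
    simp only [dot_eq_inner, hu, scaledError, ← hs, inner_zero_right, inner_smul_right,
      inner_sub_right]
    field_simp
    ring
  have h4 : ∑ i ∈ Finset.range n, (dot (0, ρ₀) (x i) + e i - dot θ (x i)) ^ 2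
      = ∑ i ∈ Finset.range n, e i ^ 2 + matForm (gramZ n x) u.1 u.1
        + 2 / s * matForm (cross n x) u.1 u.2 + matForm (gramRho n x) u.2 u.2
        - 2 * (inner ℝ (score n x e).1 u.1 + inner ℝ (score n x e).2 u.2) := by
    rw [matForm_gramZ, matForm_gramRho, matForm_cross, inner_score_fst, inner_score_snd, hss,
      ← hs]
    simp only [Finset.mul_sum, ← Finset.sum_add_distrib, ← Finset.sum_sub_distrib]
    refine Finset.sum_congr rfl fun i _ => ?_
    rw [h3 i]
    ring
  simp only [contrast, criterion, h1, h2, h4, Finset.sum_sub_distrib]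
  ring

variable {D : Matrix (Fin p₀) (Fin p₀) ℝ} {G : Matrix (Fin p₀) (Fin p₁) ℝ}
  {B : Matrix (Fin p₁) (Fin p₁) ℝ} {W : Vec p₀ p₁} {s lam γ : ℝ}
  {ρ₀ : EuclideanSpace ℝ (Fin p₁)} {u : Vec p₀ p₁} {c K Λ C : ℝ}

theorem criterion_zero (hγ₀ : 0 < γ) : criterion D G B W s lam γ ρ₀ 0 = 0 := by
  simp [criterion, matForm, Real.zero_rpow hγ₀.ne']

theorem norm_le_of_criterion_nonpos (hγ₀ : 0 < γ) (hγ₁ : γ < 1) (hρ₀ : ∀ l, ρ₀ l ≠ 0)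
    (hs : 0 < s) (hlam : 0 ≤ lam) (hΛ : lam / s ≤ Λ) (hc : 0 < c)
    (hD : ∀ a, c * ‖a‖ ^ 2 ≤ matForm D a a) (hB : ∀ a, c * ‖a‖ ^ 2 ≤ matForm B a a)
    (hG : frobNorm G ≤ K) (hK : 2 * K / s ≤ c)
    (hu : criterion D G B W s lam γ ρ₀ u ≤ 0) :
    ‖u‖ ≤ 2 / c * (4 + Λ * ∑ l, |ρ₀ l| ^ (γ - 1)) * (1 + ‖W‖) := by
  set R := ∑ l, |ρ₀ l| ^ (γ - 1) with hR
  have hR0 : 0 ≤ R := Finset.sum_nonneg fun l _ => by positivity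
  have hΛ0 : 0 ≤ Λ := (by positivity : 0 ≤ lam / s).trans hΛ
  have hx : ‖u.1‖ ≤ ‖u‖ := norm_fst_le u
  have hy : ‖u.2‖ ≤ ‖u‖ := norm_snd_le u
  have hW1 : ‖W.1‖ ≤ ‖W‖ := norm_fst_le W
  have hW2 : ‖W.2‖ ≤ ‖W‖ := norm_snd_le W
  have i1 : inner ℝ W.1 u.1 ≤ ‖W‖ * ‖u‖ := (real_inner_le_norm _ _).trans (by gcongr)
  have i2 : inner ℝ W.2 u.2 ≤ ‖W‖ * ‖u‖ := (real_inner_le_norm _ _).trans (by gcongr)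
  have hpen := mul_sum_abs_rpow_sub_le hγ₀ hγ₁ hρ₀ hlam hs u.2
  have hpen' : lam / s * R * ‖u.2‖ ≤ Λ * R * ‖u‖ := by gcongr
  have hsp : 0 ≤ lam * ∑ k, |u.1 k / s| ^ γ :=
    mul_nonneg hlam (Finset.sum_nonneg fun k _ => by positivity)
  have hcr : -(c / 2 * (‖u.1‖ ^ 2 + ‖u.2‖ ^ 2)) ≤ 2 / s * matForm G u.1 u.2 := by
    have h1 := neg_le_of_abs_le (abs_matForm_le G u.1 u.2)
    have h2 : frobNorm G * (‖u.1‖ * ‖u.2‖) ≤ K * (‖u.1‖ * ‖u.2‖) := by gcongr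
    have h3 : 2 / s * (-(K * (‖u.1‖ * ‖u.2‖))) ≤ 2 / s * matForm G u.1 u.2 := by
      gcongr; linarith
    have h4 : 2 * K / s * (‖u.1‖ * ‖u.2‖) ≤ c * (‖u.1‖ * ‖u.2‖) := by gcongr
    have h5 : 2 / s * (-(K * (‖u.1‖ * ‖u.2‖))) = -(2 * K / s * (‖u.1‖ * ‖u.2‖)) := by ring
    nlinarith [sq_nonneg (‖u.1‖ - ‖u.2‖)]
  have hmax : ‖u‖ ^ 2 ≤ ‖u.1‖ ^ 2 + ‖u.2‖ ^ 2 := by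
    rcases max_choice ‖u.1‖ ‖u.2‖ with h | h <;> rw [Prod.norm_def, h] <;> nlinarith [norm_nonneg u]
  have hfin : c / 2 * ‖u‖ ^ 2 ≤ (4 * ‖W‖ + Λ * R) * ‖u‖ := by
    have := hD u.1
    have := hB u.2
    have : c / 2 * ‖u‖ ^ 2 ≤ c / 2 * (‖u.1‖ ^ 2 + ‖u.2‖ ^ 2) := by gcongr
    unfold criterion at hu
    linarith
  rcases (norm_nonneg u).eq_or_lt with h0 | h0
  · rw [← h0]; positivity
  · have h1 : c / 2 * ‖u‖ ≤ 4 * ‖W‖ + Λ * R := by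
      refine le_of_mul_le_mul_right ?_ h0
      rw [mul_assoc, ← sq]; exact hfin
    have h2 : 4 * ‖W‖ + Λ * R ≤ (4 + Λ * R) * (1 + ‖W‖) := by
      have : 0 ≤ Λ * R * ‖W‖ := by positivity
      linarith
    calc ‖u‖ = 2 / c * (c / 2 * ‖u‖) := by field_simp
      _ ≤ 2 / c * ((4 + Λ * R) * (1 + ‖W‖)) :=
        mul_le_mul_of_nonneg_left (h1.trans h2) (by positivity)
      _ = _ := by ring

theorem penalty_le_of_criterion_le (hγ₀ : 0 < γ) (hs : 1 ≤ s)
    (hD : ∀ a, 0 ≤ matForm D a a) (hG : frobNorm G ≤ K) (hC : 0 ≤ C)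
    (hu : ‖u‖ ≤ C * (1 + ‖W‖))
    (hmin : criterion D G B W s lam γ ρ₀ u ≤ criterion D G B W s lam γ ρ₀ (0, u.2)) :
    lam * ∑ k, |u.1 k / s| ^ γ ≤ (2 * C + 2 * K * C ^ 2) * (1 + ‖W‖) ^ 2 := by
  set T := 1 + ‖W‖ with hT
  have hT0 : 0 ≤ T := by positivity
  have hK : 0 ≤ K := (frobNorm_nonneg G).trans hG
  have hx : ‖u.1‖ ≤ C * T := (norm_fst_le u).trans hu
  have hy : ‖u.2‖ ≤ C * T := (norm_snd_le u).trans hu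
  have hW1 : ‖W.1‖ ≤ T := (norm_fst_le W).trans (by rw [hT]; linarith)
  have i1 : inner ℝ W.1 u.1 ≤ T * (C * T) := (real_inner_le_norm _ _).trans (by gcongr)
  have hcr : -(2 * (K * ((C * T) * (C * T)))) ≤ 2 / s * matForm G u.1 u.2 := by
    have h1 : |2 / s * matForm G u.1 u.2| ≤ 2 * (K * ((C * T) * (C * T))) := by
      rw [abs_mul, abs_of_nonneg (by positivity : 0 ≤ 2 / s)]
      refine mul_le_mul (div_le_self (by norm_num) hs) ?_ (abs_nonneg _) (by norm_num)
      exact (abs_matForm_le G u.1 u.2).trans (by gcongr)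
    exact neg_le_of_abs_le h1
  have e : criterion D G B W s lam γ ρ₀ (0, u.2) = matForm B u.2 u.2
      - 2 * inner ℝ W.2 u.2 + lam * ∑ l, (|ρ₀ l + u.2 l / s| ^ γ - |ρ₀ l| ^ γ) := by
    simp [criterion, matForm, Real.zero_rpow hγ₀.ne']
  rw [e] at hmin
  unfold criterion at hmin
  have := hD u.1
  nlinarith

theorem sq_norm_sub_le_of_criterion_le (hγ₀ : 0 < γ) (hγ₁ : γ < 1) (hρ₀ : ∀ l, ρ₀ l ≠ 0)
    (hs : 0 < s) (hlam : 0 ≤ lam) {lam₀ : ℝ} {B₀ : Matrix (Fin p₁) (Fin p₁) ℝ}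
    (hB₀ : B₀.IsSymm) (hB : ∀ a, c * ‖a‖ ^ 2 ≤ matForm B₀ a a) (hG : frobNorm G ≤ K)
    {v : EuclideanSpace ℝ (Fin p₁)}
    (hv : ∀ w, matForm B₀ v w = inner ℝ W.2 w - lam₀ * ∑ l, upsilon γ ρ₀ l * w l)
    (hu : ‖u‖ ≤ C * (1 + ‖W‖)) (hvC : ‖v‖ ≤ C * (1 + ‖W‖)) (hC : 0 ≤ C)
    (hmin : criterion D G B W s lam γ ρ₀ u ≤ criterion D G B W s lam γ ρ₀ (u.1, v)) :
    c * ‖u.2 - v‖ ^ 2 ≤ 2 * (2 / s * (K * C ^ 2) + frobNorm (B - B₀) * C ^ 2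
      + |lam / s - lam₀| * (2 * ∑ l, |upsilon γ ρ₀ l|) * C
      + lam / s / s * (∑ l, 2 * |ρ₀ l| ^ γ / ρ₀ l ^ 2) * C ^ 2) * (1 + ‖W‖) ^ 2 := by
  set T := 1 + ‖W‖ with hT
  have hT1 : 1 ≤ T := by rw [hT]; linarith [norm_nonneg W]
  have hK : 0 ≤ K := (frobNorm_nonneg G).trans hG
  set U := 2 * ∑ l, |upsilon γ ρ₀ l| with hU
  have hU0 : 0 ≤ U := mul_nonneg two_pos.le (Finset.sum_nonneg fun l _ => abs_nonneg _)
  set R := ∑ l, 2 * |ρ₀ l| ^ γ / ρ₀ l ^ 2 with hR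
  have hR0 : 0 ≤ R := Finset.sum_nonneg fun l _ => by positivity
  set E := 2 / s * (K * C ^ 2) + frobNorm (B - B₀) * C ^ 2 + |lam / s - lam₀| * U * C
      + lam / s / s * R * C ^ 2 with hE
  set base := matForm D u.1 u.1 - 2 * inner ℝ W.1 u.1 + lam * ∑ k, |u.1 k / s| ^ γ
    - matForm B₀ v v with hbase
  have hx : ‖u.1‖ ≤ C * T := (norm_fst_le u).trans hu
  have key : ∀ w : EuclideanSpace ℝ (Fin p₁), ‖w‖ ≤ C * T →
      |criterion D G B W s lam γ ρ₀ (u.1, w) - base - matForm B₀ (w - v) (w - v)| ≤ E * T ^ 2 := by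
    intro w hw
    have hsymm : matForm B₀ w v = matForm B₀ v w := by
      simp only [matForm]
      rw [Matrix.dotProduct_mulVec, ← Matrix.mulVec_transpose, hB₀.eq, dotProduct_comm]
    have e : criterion D G B W s lam γ ρ₀ (u.1, w) - base - matForm B₀ (w - v) (w - v)
        = 2 / s * matForm G u.1 w + matForm (B - B₀) w w
          + (lam * ∑ l, (|ρ₀ l + w l / s| ^ γ - |ρ₀ l| ^ γ)
            - 2 * lam₀ * ∑ l, upsilon γ ρ₀ l * w l) := by
      rw [matForm_sub_sub_of_isSymm hB₀, hsymm, hv w, matForm_sub]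
      simp only [criterion, hbase]
      ring
    rw [e]
    have b1 : |2 / s * matForm G u.1 w| ≤ 2 / s * (K * ((C * T) * (C * T))) := by
      rw [abs_mul, abs_of_nonneg (by positivity : 0 ≤ 2 / s)]
      gcongr
      exact (abs_matForm_le G u.1 w).trans (by gcongr)
    have b2 : |matForm (B - B₀) w w| ≤ frobNorm (B - B₀) * ((C * T) * (C * T)) :=
      (abs_matForm_le _ w w).trans (by have := frobNorm_nonneg (B - B₀); gcongr)
    have b3 := abs_penalty_sub_linear_le hγ₀ hγ₁ hρ₀ hlam hs lam₀ w
    rw [← hU, ← hR] at b3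
    have b4 : |lam / s - lam₀| * U * ‖w‖ ≤ |lam / s - lam₀| * U * (C * T ^ 2) := by
      gcongr
      exact hw.trans (by gcongr; nlinarith)
    have b5 : lam / s / s * R * ‖w‖ ^ 2 ≤ lam / s / s * R * (C * T) ^ 2 := by gcongr
    refine (abs_add_le _ _).trans ((add_le_add_left (abs_add_le _ _) _).trans ?_)
    have : E * T ^ 2 = 2 / s * (K * ((C * T) * (C * T)))
        + frobNorm (B - B₀) * ((C * T) * (C * T)) + |lam / s - lam₀| * U * (C * T ^ 2)
        + lam / s / s * R * (C * T) ^ 2 := by rw [hE]; ring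
    linarith
  have k1 := (abs_le.1 (key u.2 ((norm_snd_le u).trans hu))).1
  have k2 := (abs_le.1 (key v hvC)).2
  have k3 : matForm B₀ (v - v) (v - v) = 0 := by simp [matForm]
  have k4 := hB (u.2 - v)
  rw [k3] at k2
  have k5 : criterion D G B W s lam γ ρ₀ (u.1, u.2) = criterion D G B W s lam γ ρ₀ u := rfl
  linarith

end Criterion

/-! ### Approximation of the rescaled estimation error -/

section Approximation

variable {p₀ p₁ : ℕ}

/-- The minimizer `B₀⁻¹ (w - lam₀ Υ)` of the limiting criterion. -/
noncomputable def center (B₀ : Matrix (Fin p₁) (Fin p₁) ℝ) (lam₀ γ : ℝ)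
    (ρ₀ w : EuclideanSpace ℝ (Fin p₁)) : EuclideanSpace ℝ (Fin p₁) :=
  Matrix.toEuclideanCLM (𝕜 := ℝ) B₀⁻¹ (w - lam₀ • WithLp.toLp 2 (upsilon γ ρ₀))

theorem matForm_center {B₀ : Matrix (Fin p₁) (Fin p₁) ℝ} (hB₀ : B₀.PosDef) (lam₀ γ : ℝ)
    (ρ₀ w a : EuclideanSpace ℝ (Fin p₁)) :
    matForm B₀ (center B₀ lam₀ γ ρ₀ w) a
      = inner ℝ w a - lam₀ * ∑ l, upsilon γ ρ₀ l * a l := by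
  have hsymm : B₀.transpose = B₀ := by simpa using hB₀.isHermitian.eq
  have hdet : IsUnit B₀.det := hB₀.det_pos.ne'.isUnit
  have h : B₀.mulVec (B₀⁻¹.mulVec (w.ofLp - lam₀ • upsilon γ ρ₀))
      = w.ofLp - lam₀ • upsilon γ ρ₀ := by
    rw [Matrix.mulVec_mulVec, Matrix.mul_nonsing_inv _ hdet, Matrix.one_mulVec]
  rw [matForm, Matrix.dotProduct_mulVec, ← Matrix.mulVec_transpose, hsymm]
  simp only [center, Matrix.ofLp_toEuclideanCLM, WithLp.ofLp_sub, WithLp.ofLp_smul, h,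
    sub_dotProduct, smul_dotProduct, smul_eq_mul]
  congr 1
  simp [PiLp.inner_apply, dotProduct, mul_comm]

theorem exists_norm_center_le (B₀ : Matrix (Fin p₁) (Fin p₁) ℝ) (lam₀ γ : ℝ)
    (ρ₀ : EuclideanSpace ℝ (Fin p₁)) :
    ∃ C : ℝ, 0 ≤ C ∧ ∀ w, ‖center B₀ lam₀ γ ρ₀ w‖ ≤ C * (1 + ‖w‖) := by
  set A := Matrix.toEuclideanCLM (𝕜 := ℝ) B₀⁻¹
  set b : EuclideanSpace ℝ (Fin p₁) := lam₀ • WithLp.toLp 2 (upsilon γ ρ₀)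
  refine ⟨‖A‖ * (1 + ‖b‖), by positivity, fun w => (A.le_opNorm _).trans ?_⟩
  rw [mul_assoc]
  gcongr
  refine (norm_sub_le _ _).trans ?_
  nlinarith [norm_nonneg w, norm_nonneg b]

theorem norm_le_sum_abs {m : ℕ} (a : EuclideanSpace ℝ (Fin m)) : ‖a‖ ≤ ∑ k, |a k| := by
  rw [EuclideanSpace.norm_eq]
  refine Real.sqrt_le_iff.2 ⟨Finset.sum_nonneg fun k _ => abs_nonneg _, ?_⟩
  simpa using Finset.sum_sq_le_sq_sum_of_nonneg (s := Finset.univ) (f := fun k => |a k|)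
    fun k _ => abs_nonneg _

theorem criterion_le_of_isMinOn {n : ℕ} (hn : 0 < n) {x : ℕ → Vec p₀ p₁} {e : ℕ → ℝ} {lam γ : ℝ}
    {ρ₀ : EuclideanSpace ℝ (Fin p₁)} {Θ : Set (Vec p₀ p₁)} {θ θ' : Vec p₀ p₁}
    (hmin : IsMinOn (contrast n x (fun i => dot (0, ρ₀) (x i) + e i) lam γ) Θ θ) (hθ' : θ' ∈ Θ) :
    criterion (gramZ n x) (cross n x) (gramRho n x) (score n x e) (√(n : ℝ)) lam γ ρ₀
        (scaledError ρ₀ n θ)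
      ≤ criterion (gramZ n x) (cross n x) (gramRho n x) (score n x e) (√(n : ℝ)) lam γ ρ₀
        (scaledError ρ₀ n θ') := by
  have h := hmin hθ'
  simp only [Set.mem_ofPred_eq, contrast_eq_criterion hn] at h
  linarith

theorem eventually_le_matForm {m : ℕ} {A : ℕ → Matrix (Fin m) (Fin m) ℝ}
    {A₀ : Matrix (Fin m) (Fin m) ℝ} {c : ℝ} (hc : 0 < c)
    (hA₀ : ∀ a, c * ‖a‖ ^ 2 ≤ matForm A₀ a a)
    (hA : Tendsto (fun n => frobNorm (A n - A₀)) atTop (𝓝 0)) :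
    ∀ᶠ n in atTop, ∀ a, c / 2 * ‖a‖ ^ 2 ≤ matForm (A n) a a := by
  filter_upwards [hA.eventually_lt_const (half_pos hc)] with n hn a
  have h1 := neg_le_of_abs_le (abs_matForm_le (A n - A₀) a a)
  rw [matForm_sub] at h1
  have h2 : frobNorm (A n - A₀) * (‖a‖ * ‖a‖) ≤ c / 2 * (‖a‖ * ‖a‖) := by gcongr
  have h3 := hA₀ a
  nlinarith

theorem tendsto_frobNorm_sub_of_rate {m : ℕ} {A : ℕ → Matrix (Fin m) (Fin m) ℝ}
    {A₀ : Matrix (Fin m) (Fin m) ℝ} {δ K : ℝ} (hδ : 0 < δ)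
    (hA : ∀ n : ℕ, 0 < n → (n : ℝ) ^ δ * frobNorm (A n - A₀) ≤ K) :
    Tendsto (fun n => frobNorm (A n - A₀)) atTop (𝓝 0) := by
  have h1 : Tendsto (fun n : ℕ => K / (n : ℝ) ^ δ) atTop (𝓝 0) :=
    tendsto_const_nhds.div_atTop ((tendsto_rpow_atTop hδ).comp tendsto_natCast_atTop_atTop)
  refine squeeze_zero' (Eventually.of_forall fun n => frobNorm_nonneg _) ?_ h1
  filter_upwards [eventually_gt_atTop 0] with n hn
  have : 0 < (n : ℝ) ^ δ := by positivity
  rw [le_div_iff₀ this, mul_comm]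
  exact hA n hn

theorem tendsto_sqrt_natCast_atTop : Tendsto (fun n : ℕ => √(n : ℝ)) atTop atTop :=
  Real.tendsto_sqrt_atTop.comp tendsto_natCast_atTop_atTop

theorem norm_le_of_mul_sum_rpow_le {m : ℕ} {a : EuclideanSpace ℝ (Fin m)} {γ lam s C T : ℝ}
    (hγ₀ : 0 < γ) (hlam : 0 < lam) (hs : 0 < s) (hC : 0 ≤ C) (hT : 1 ≤ T)
    (h : lam * ∑ k, |a k / s| ^ γ ≤ C * T ^ 2) :
    ‖a‖ ≤ m * ((C / (lam / s ^ γ)) ^ (1 / γ) * T ^ ⌈2 / γ⌉₊) := by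
  have hsγ : 0 < s ^ γ := by positivity
  have hk : ∀ k, |a k| ≤ (C / (lam / s ^ γ)) ^ (1 / γ) * T ^ ⌈2 / γ⌉₊ := by
    intro k
    have h2 : lam * |a k / s| ^ γ ≤ C * T ^ 2 := by
      refine le_trans ?_ h
      gcongr
      exact Finset.single_le_sum (f := fun k => |a k / s| ^ γ)
        (fun k _ => by positivity) (Finset.mem_univ k)
    rw [abs_div, abs_of_pos hs, Real.div_rpow (abs_nonneg _) hs.le] at h2
    have h3 : |a k| ^ γ ≤ C / (lam / s ^ γ) * T ^ 2 := by
      rw [div_mul_eq_mul_div, le_div_iff₀ (by positivity)]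
      calc _ = lam * (|a k| ^ γ / s ^ γ) := by ring
        _ ≤ _ := h2
    calc |a k| = (|a k| ^ γ) ^ (1 / γ) := by
          rw [← Real.rpow_mul (abs_nonneg _), mul_one_div_cancel hγ₀.ne', Real.rpow_one]
      _ ≤ (C / (lam / s ^ γ) * T ^ 2) ^ (1 / γ) :=
          Real.rpow_le_rpow (by positivity) h3 (by positivity)
      _ = (C / (lam / s ^ γ)) ^ (1 / γ) * T ^ (2 / γ) := by
          rw [Real.mul_rpow (by positivity) (by positivity), ← Real.rpow_natCast T 2,
            ← Real.rpow_mul (by positivity)]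
          congr 2
          push_cast; ring
      _ ≤ _ := by
          rw [← Real.rpow_natCast]
          exact mul_le_mul_of_nonneg_left
            (Real.rpow_le_rpow_of_exponent_le hT (Nat.le_ceil _)) (by positivity)
  refine (norm_le_sum_abs _).trans ((Finset.sum_le_sum fun k _ => hk k).trans ?_)
  simp

theorem le_sqrt_mul_sq_of_mul_sq_le {c y H T : ℝ} (hc : 0 < c) (hH : 0 ≤ H) (hT : 1 ≤ T)
    (h : c * y ^ 2 ≤ H * T ^ 3) : y ≤ √(H / c) * T ^ 2 := by
  have h1 : y ^ 2 ≤ H / c * T ^ 3 := by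
    rw [div_mul_eq_mul_div, le_div_iff₀ hc, mul_comm]; exact h
  have h2 : H / c * T ^ 3 ≤ H / c * T ^ 4 :=
    mul_le_mul_of_nonneg_left (pow_le_pow_right₀ hT (by norm_num)) (by positivity)
  have h3 : (√(H / c) * T ^ 2) ^ 2 = H / c * T ^ 4 := by
    rw [mul_pow, Real.sq_sqrt (by positivity)]; ring
  exact (le_abs_self y).trans (abs_le_of_sq_le_sq (by rw [h3]; exact h1.trans h2) (by positivity))

theorem exists_scaledError_approx
    {Θ₀ : Set (EuclideanSpace ℝ (Fin p₀))} {Θ₁ : Set (EuclideanSpace ℝ (Fin p₁))}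
    {ρ₀ : EuclideanSpace ℝ (Fin p₁)} (hρ₀ : ∀ l, ρ₀ l ≠ 0)
    (hz_int : (0 : EuclideanSpace ℝ (Fin p₀)) ∈ interior Θ₀) (hρ_int : ρ₀ ∈ interior Θ₁)
    {γ : ℝ} (hγ₀ : 0 < γ) (hγ₁ : γ < 1) {lam : ℕ → ℝ} {lam₀ : ℝ}
    (hlam_top : Tendsto (fun n : ℕ => lam n / (n : ℝ) ^ (γ / 2)) atTop atTop)
    (hlam_lim : Tendsto (fun n : ℕ => lam n / √(n : ℝ)) atTop (𝓝 lam₀))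
    {X : ℕ → ℕ → Vec p₀ p₁}
    {D₀ : Matrix (Fin p₀) (Fin p₀) ℝ} (hD₀ : D₀.PosDef)
    (hD : Tendsto (fun n : ℕ => gramZ n (X n)) atTop (𝓝 D₀))
    {B₀ : Matrix (Fin p₁) (Fin p₁) ℝ} (hB₀ : B₀.PosDef)
    (hB : Tendsto (fun n : ℕ => frobNorm (gramRho n (X n) - B₀)) atTop (𝓝 0))
    {K : ℝ} (hcross : ∀ n : ℕ, 0 < n → frobNorm (cross n (X n)) ≤ K) :
    ∃ C : ℝ, 0 ≤ C ∧ ∃ a : ℕ → ℝ, Tendsto a atTop (𝓝 0) ∧ ∃ m : ℕ, ∀ᶠ n in atTop,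
      ∀ (e : ℕ → ℝ) (θ : Vec p₀ p₁), θ ∈ Θ₀ ×ˢ Θ₁ →
        IsMinOn (contrast n (X n) (fun i => dot (0, ρ₀) (X n i) + e i) (lam n) γ) (Θ₀ ×ˢ Θ₁) θ →
        ‖scaledError ρ₀ n θ‖ ≤ C * (1 + ‖score n (X n) e‖) ∧
        ‖scaledError ρ₀ n θ - (0, center B₀ lam₀ γ ρ₀ (score n (X n) e).2)‖
          ≤ a n * (1 + ‖score n (X n) e‖) ^ m := by
  obtain ⟨cD, hcD, hcD'⟩ := exists_mul_sq_norm_le_matForm hD₀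
  obtain ⟨cB, hcB, hcB'⟩ := exists_mul_sq_norm_le_matForm hB₀
  obtain ⟨Cv, hCv, hCv'⟩ := exists_norm_center_le B₀ lam₀ γ ρ₀
  obtain ⟨r, hr, hrΘ⟩ := Metric.isOpen_iff.1 isOpen_interior _ hρ_int
  have hsymm : B₀.IsSymm := by simpa [Matrix.IsSymm] using hB₀.isHermitian.eq
  have hK0 : 0 ≤ K := (frobNorm_nonneg _).trans (hcross 1 one_pos)
  set c := min (cD / 2) (cB / 2) with hc
  have hc0 : 0 < c := lt_min (half_pos hcD) (half_pos hcB)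
  set Λ := lam₀ + 1
  have hlam₀ : 0 ≤ lam₀ := by
    refine ge_of_tendsto hlam_lim ?_
    filter_upwards [hlam_top.eventually_gt_atTop 0, eventually_gt_atTop 0] with n hn hn0
    have : 0 < (n : ℝ) ^ (γ / 2) := by positivity
    have : 0 < lam n := (div_pos_iff_of_pos_right this).1 hn
    positivity
  have hR0 : 0 ≤ ∑ l, |ρ₀ l| ^ (γ - 1) := Finset.sum_nonneg fun l _ => by positivity
  set C₁ := 2 / c * (4 + Λ * ∑ l, |ρ₀ l| ^ (γ - 1)) with hC₁
  have hC₁0 : 0 ≤ C₁ := by positivity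
  set C := max C₁ Cv with hC
  have hC0 : 0 ≤ C := hC₁0.trans (le_max_left _ _)
  set C₂ := 2 * C + 2 * K * C ^ 2 with hC₂
  have hC₂0 : 0 ≤ C₂ := by positivity
  set E : ℕ → ℝ := fun n => 2 / √(n : ℝ) * (K * C ^ 2)
    + frobNorm (gramRho n (X n) - B₀) * C ^ 2
    + |lam n / √(n : ℝ) - lam₀| * (2 * ∑ l, |upsilon γ ρ₀ l|) * C
    + lam n / √(n : ℝ) / √(n : ℝ) * (∑ l, 2 * |ρ₀ l| ^ γ / ρ₀ l ^ 2) * C ^ 2 with hE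
  have hsqrt := tendsto_sqrt_natCast_atTop
  have hE0 : Tendsto E atTop (𝓝 0) := by
    have t1 : Tendsto (fun n : ℕ => 2 / √(n : ℝ) * (K * C ^ 2)) atTop (𝓝 0) := by
      simpa using (tendsto_const_nhds.div_atTop hsqrt).mul_const (K * C ^ 2)
    have t2 : Tendsto (fun n : ℕ => frobNorm (gramRho n (X n) - B₀) * C ^ 2) atTop (𝓝 0) := by
      simpa using hB.mul_const (C ^ 2)
    have t3 : Tendsto (fun n : ℕ => |lam n / √(n : ℝ) - lam₀|
        * (2 * ∑ l, |upsilon γ ρ₀ l|) * C) atTop (𝓝 0) := by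
      have h := (hlam_lim.sub_const lam₀).abs
      rw [sub_self, abs_zero] at h
      simpa using (h.mul_const (2 * ∑ l, |upsilon γ ρ₀ l|)).mul_const C
    have t4 : Tendsto (fun n : ℕ => lam n / √(n : ℝ) / √(n : ℝ)
        * (∑ l, 2 * |ρ₀ l| ^ γ / ρ₀ l ^ 2) * C ^ 2) atTop (𝓝 0) := by
      simpa using ((hlam_lim.div_atTop hsqrt).mul_const
        (∑ l, 2 * |ρ₀ l| ^ γ / ρ₀ l ^ 2)).mul_const (C ^ 2)
    simpa using ((t1.add t2).add t3).add t4
  set h : ℕ → ℝ := fun n => (2 * E n + 4 * c * C ^ 3 / r / √(n : ℝ)) / c with hh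
  have hh0 : Tendsto h atTop (𝓝 0) := by
    have t : Tendsto (fun n : ℕ => 4 * c * C ^ 3 / r / √(n : ℝ)) atTop (𝓝 0) :=
      tendsto_const_nhds.div_atTop hsqrt
    simpa using ((hE0.const_mul 2).add t).div_const c
  set b : ℕ → ℝ := fun n => (C₂ / (lam n / (n : ℝ) ^ (γ / 2))) ^ (1 / γ) with hb
  have hb0 : Tendsto b atTop (𝓝 0) := by
    have t : Tendsto (fun n : ℕ => C₂ / (lam n / (n : ℝ) ^ (γ / 2))) atTop (𝓝 0) :=
      tendsto_const_nhds.div_atTop hlam_top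
    have := t.rpow_const (p := 1 / γ) (Or.inr (by positivity))
    rwa [Real.zero_rpow (by positivity)] at this
  refine ⟨C, hC0, fun n => p₀ * b n + √(h n), ?_, ⌈2 / γ⌉₊ + 2, ?_⟩
  · have t := hh0.sqrt
    rw [Real.sqrt_zero] at t
    simpa using (hb0.const_mul (p₀ : ℝ)).add t
  have hD' : Tendsto (fun n => frobNorm (gramZ n (X n) - D₀)) atTop (𝓝 0) := by
    have := (continuous_frobNorm.tendsto _).comp (hD.sub_const D₀)
    rw [sub_self, show frobNorm (0 : Matrix (Fin p₀) (Fin p₀) ℝ) = 0 by simp [frobNorm]] at this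
    exact this
  have hKc : ∀ᶠ n : ℕ in atTop, 2 * K / √(n : ℝ) ≤ c :=
    (tendsto_const_nhds.div_atTop hsqrt).eventually_le_const hc0
  filter_upwards [hlam_top.eventually_gt_atTop 0, eventually_gt_atTop 0,
    eventually_le_matForm hcD hcD' hD', eventually_le_matForm hcB hcB' hB, hKc,
    hlam_lim.eventually_le_const (lt_add_one lam₀)] with n hμ hn hDn hBn hKn hΛn e θ hθ hmin
  have hpow : 0 < (n : ℝ) ^ (γ / 2) := by positivity
  have hlam : 0 < lam n := (div_pos_iff_of_pos_right hpow).1 hμ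
  have hs0 : 0 < √(n : ℝ) := by positivity
  have hs1 : 1 ≤ √(n : ℝ) := Real.one_le_sqrt.2 (by exact_mod_cast hn)
  set s := √(n : ℝ) with hs
  set W := score n (X n) e with hW
  set T := 1 + ‖W‖ with hT
  have hT1 : 1 ≤ T := by rw [hT]; linarith [norm_nonneg W]
  set u := scaledError ρ₀ n θ with hu
  have hDn' : ∀ a, c * ‖a‖ ^ 2 ≤ matForm (gramZ n (X n)) a a := fun a =>
    le_trans (by gcongr; exact min_le_left _ _) (hDn a)
  have hBn' : ∀ a, c * ‖a‖ ^ 2 ≤ matForm (gramRho n (X n)) a a := fun a =>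
    le_trans (by gcongr; exact min_le_right _ _) (hBn a)
  have hB₀' : ∀ a, c * ‖a‖ ^ 2 ≤ matForm B₀ a a := fun a => by
    refine le_trans ?_ (hcB' a)
    gcongr
    exact (min_le_right _ _).trans (by linarith)
  have huC₁ : ‖u‖ ≤ C₁ * T := by
    refine norm_le_of_criterion_nonpos hγ₀ hγ₁ hρ₀ hs0 hlam.le hΛn hc0 hDn' hBn' (hcross n hn) hKn ?_
    have h1 := criterion_le_of_isMinOn hn hmin (θ' := (0, ρ₀))
      ⟨interior_subset hz_int, interior_subset hρ_int⟩
    have h2 : scaledError ρ₀ n ((0, ρ₀) : Vec p₀ p₁) = 0 := by simp [scaledError]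
    rwa [h2, criterion_zero hγ₀] at h1
  have huC : ‖u‖ ≤ C * T := huC₁.trans (by gcongr; exact le_max_left _ _)
  refine ⟨huC, ?_⟩
  set v := center B₀ lam₀ γ ρ₀ W.2 with hv
  have hvC : ‖v‖ ≤ C * T := by
    refine (hCv' _).trans ?_
    have : ‖W.2‖ ≤ ‖W‖ := norm_snd_le W
    exact mul_le_mul (le_max_right _ _) (by rw [hT]; linarith) (by positivity) hC0
  have h1 : ‖u.1‖ ≤ p₀ * (b n * T ^ ⌈2 / γ⌉₊) := by
    have hpen : lam n * ∑ k, |u.1 k / s| ^ γ ≤ C₂ * T ^ 2 := by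
      refine penalty_le_of_criterion_le (B := gramRho n (X n)) (ρ₀ := ρ₀) hγ₀ hs1 (fun a => (by positivity : 0 ≤ c * ‖a‖ ^ 2).trans
        (hDn' a)) (hcross n hn) hC0 huC ?_
      have h1 := criterion_le_of_isMinOn hn hmin (θ' := (0, θ.2))
        ⟨interior_subset hz_int, hθ.2⟩
      have h2 : scaledError ρ₀ n ((0, θ.2) : Vec p₀ p₁) = (0, u.2) := by simp [scaledError, hu]
      rwa [h2] at h1
    have hsγ : s ^ γ = (n : ℝ) ^ (γ / 2) := by
      rw [hs, Real.sqrt_eq_rpow, ← Real.rpow_mul n.cast_nonneg]; congr 1; ring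
    have := norm_le_of_mul_sum_rpow_le hγ₀ hlam hs0 hC₂0 hT1 hpen
    rwa [hsγ] at this
  have hEn0 : 0 ≤ E n := by
    have a1 := frobNorm_nonneg (gramRho n (X n) - B₀)
    have a2 : 0 ≤ ∑ l, |upsilon γ ρ₀ l| := Finset.sum_nonneg fun l _ => abs_nonneg _
    have a3 : 0 ≤ ∑ l, 2 * |ρ₀ l| ^ γ / ρ₀ l ^ 2 := Finset.sum_nonneg fun l _ => by positivity
    simp only [hE]
    positivity
  have h2 : ‖u.2 - v‖ ≤ √(h n) * T ^ 2 := by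
    have hsq : c * ‖u.2 - v‖ ^ 2 ≤ (2 * E n + 4 * c * C ^ 3 / r / s) * T ^ 3 := by
      rcases lt_or_ge ‖v‖ (r * s) with hvs | hvs
      · have hmem : ρ₀ + s⁻¹ • v ∈ Θ₁ := by
          refine interior_subset (hrΘ ?_)
          rw [Metric.mem_ball, dist_eq_norm, add_sub_cancel_left, norm_smul, norm_inv,
            Real.norm_of_nonneg hs0.le, inv_mul_lt_iff₀ hs0]
          linarith
        have h3 := criterion_le_of_isMinOn hn hmin (θ' := (θ.1, ρ₀ + s⁻¹ • v)) ⟨hθ.1, hmem⟩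
        have h4 : scaledError ρ₀ n ((θ.1, ρ₀ + s⁻¹ • v) : Vec p₀ p₁) = (u.1, v) := by
          simp [scaledError, hu, ← hs, smul_smul, hs0.ne']
        rw [h4] at h3
        have h5 := sq_norm_sub_le_of_criterion_le hγ₀ hγ₁ hρ₀ hs0 hlam.le hsymm hB₀' (hcross n hn)
          (matForm_center hB₀ lam₀ γ ρ₀ W.2) huC hvC hC0 h3
        refine h5.trans ?_
        have : 0 ≤ 4 * c * C ^ 3 / r / s := by positivity
        calc 2 * E n * T ^ 2 ≤ 2 * E n * T ^ 3 :=
              mul_le_mul_of_nonneg_left (pow_le_pow_right₀ hT1 (by norm_num)) (by positivity)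
          _ ≤ _ := by gcongr; linarith
      · have h3 : ‖u.2 - v‖ ≤ 2 * (C * T) := by
          refine (norm_sub_le _ _).trans ?_
          have := (norm_snd_le u).trans huC
          linarith
        have h4 : 1 ≤ C * T / (r * s) := by
          rw [one_le_div (by positivity)]; exact hvs.trans hvC
        calc c * ‖u.2 - v‖ ^ 2 ≤ c * (2 * (C * T)) ^ 2 := by gcongr
          _ ≤ c * (2 * (C * T)) ^ 2 * (C * T / (r * s)) :=
            le_mul_of_one_le_right (by positivity) h4
          _ = 4 * c * C ^ 3 / r / s * T ^ 3 := by field_simp; ring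
          _ ≤ _ := by gcongr; linarith
    exact le_sqrt_mul_sq_of_mul_sq_le hc0 (by positivity) hT1 hsq
  have hb1 : 0 ≤ b n := Real.rpow_nonneg (by positivity) _
  have g1 : (p₀ : ℝ) * (b n * T ^ ⌈2 / γ⌉₊) ≤ p₀ * b n * T ^ (⌈2 / γ⌉₊ + 2) := by
    rw [← mul_assoc]
    exact mul_le_mul_of_nonneg_left (pow_le_pow_right₀ hT1 (by omega)) (by positivity)
  have g2 : √(h n) * T ^ 2 ≤ √(h n) * T ^ (⌈2 / γ⌉₊ + 2) :=
    mul_le_mul_of_nonneg_left (pow_le_pow_right₀ hT1 (by omega)) (by positivity)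
  have g3 : 0 ≤ (p₀ : ℝ) * b n * T ^ (⌈2 / γ⌉₊ + 2) := by positivity
  have g4 : 0 ≤ √(h n) * T ^ (⌈2 / γ⌉₊ + 2) := by positivity
  rw [add_mul, Prod.norm_def]
  refine max_le ?_ ?_
  · simp only [Prod.fst_sub, sub_zero]
    linarith
  · simp only [Prod.snd_sub]
    linarith

end Approximation

/-! ### Moments of the score -/

theorem one_add_sum_abs_pow_le {ι : Type*} [Fintype ι] (k : ℕ) (w : ι → ℝ) :
    (1 + ∑ j, |w j|) ^ (2 * (k + 1)) ≤ 2 ^ (2 * (k + 1))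
      * (1 + (Fintype.card ι : ℝ) ^ (2 * k + 1) * ∑ j, w j ^ (2 * (k + 1))) := by
  have h0 : 0 ≤ ∑ j, |w j| := Finset.sum_nonneg fun j _ => abs_nonneg _
  have h1 := add_pow_le zero_le_one h0 (2 * (k + 1))
  have h3 : (∑ j, |w j|) ^ (2 * (k + 1))
      ≤ (Fintype.card ι : ℝ) ^ (2 * k + 1) * ∑ j, w j ^ (2 * (k + 1)) := by
    have := pow_sum_le_card_mul_sum_pow (s := Finset.univ) (f := fun j => |w j|)
      (fun j _ => abs_nonneg _) (2 * k + 1)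
    simpa [show 2 * (k + 1) = 2 * k + 1 + 1 by ring, (show Even (2 * k + 1 + 1) from
      ⟨k + 1, by ring⟩).pow_abs] using this
  refine h1.trans ?_
  rw [one_pow]
  have : 0 ≤ (∑ j, |w j|) ^ (2 * (k + 1)) := by positivity
  exact mul_le_mul (pow_le_pow_right₀ one_le_two (by omega)) (by linarith) (by positivity)
    (by positivity)

section Score

variable {Ω : Type*} [MeasurableSpace Ω] {P : Measure Ω} [IsProbabilityMeasure P]
  {ε : ℕ → Ω → ℝ} {p₀ p₁ : ℕ} {X : ℕ → ℕ → Vec p₀ p₁}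

omit [IsProbabilityMeasure P] in
theorem aemeasurable_score (hε : ∀ i, AEMeasurable (ε i) P) (n : ℕ) (x : ℕ → Vec p₀ p₁) :
    AEMeasurable (fun ω => score n x fun i => ε i ω) P := by
  have h : AEMeasurable (fun ω => ∑ i ∈ Finset.range n, ε i ω • x i) P :=
    Finset.aemeasurable_fun_sum _ fun i _ => (hε i).smul_const _
  exact h.const_smul (√(n : ℝ))⁻¹

theorem exists_integral_inv_sqrt_mul_sum_pow_le (hindep : iIndepFun ε P)
    (hL : ∀ i, ∀ k : ℕ, MemLp (ε i) k P) (hmean : ∀ i, ∫ ω, ε i ω ∂P = 0)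
    (hbd : ∀ k : ℕ, ∃ M : ℝ, ∀ i, ∫ ω, |ε i ω| ^ k ∂P ≤ M) (K : ℝ) (m : ℕ) :
    ∃ C : ℝ, 0 ≤ C ∧ ∀ (n : ℕ) (a : ℕ → ℝ), (∀ i < n, |a i| ≤ K) →
      ∫ ω, ((√(n : ℝ))⁻¹ * ∑ i ∈ Finset.range n, a i * ε i ω) ^ (2 * m) ∂P ≤ C := by
  obtain ⟨C, hC, h⟩ := exists_integral_sum_pow_le hindep hL hmean hbd K m
  refine ⟨C, hC, fun n a ha => ?_⟩
  simp only [mul_pow, integral_const_mul]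
  have h1 : (√(n : ℝ))⁻¹ ^ (2 * m) = ((n : ℝ) ^ m)⁻¹ := by
    rw [inv_pow, pow_mul, Real.sq_sqrt n.cast_nonneg]
  rw [h1]
  calc _ ≤ ((n : ℝ) ^ m)⁻¹ * (C * (n : ℝ) ^ m) := by gcongr; exact h n a ha
    _ = C * (((n : ℝ) ^ m)⁻¹ * (n : ℝ) ^ m) := by ring
    _ ≤ C * 1 := by gcongr; exact inv_mul_le_one
    _ = C := mul_one C

theorem exists_integral_one_add_norm_score_pow_le (hindep : iIndepFun ε P)
    (hL : ∀ i, ∀ k : ℕ, MemLp (ε i) k P) (hmean : ∀ i, ∫ ω, ε i ω ∂P = 0)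
    (hbd : ∀ k : ℕ, ∃ M : ℝ, ∀ i, ∫ ω, |ε i ω| ^ k ∂P ≤ M) {K : ℝ}
    (hX : ∀ n : ℕ, 0 < n → ∀ i < n, ‖X n i‖ ≤ K) (k : ℕ) :
    ∃ C : ℝ, ∀ n, Integrable (fun ω => (1 + ‖score n (X n) fun i => ε i ω‖) ^ k) P ∧
      ∫ ω, (1 + ‖score n (X n) fun i => ε i ω‖) ^ k ∂P ≤ C := by
  obtain ⟨C, hC, h⟩ := exists_integral_inv_sqrt_mul_sum_pow_le hindep hL hmean hbd K (k + 1)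
  let x : ℕ → ℕ → Fin p₀ ⊕ Fin p₁ → ℝ := fun n i => Sum.elim (X n i).1.ofLp (X n i).2.ofLp
  let w : ℕ → Fin p₀ ⊕ Fin p₁ → Ω → ℝ := fun n j ω =>
    (√(n : ℝ))⁻¹ * ∑ i ∈ Finset.range n, x n i j * ε i ω
  have hw1 : ∀ n ω k, (score n (X n) fun i => ε i ω).1 k = w n (Sum.inl k) ω := fun n ω k => by
    simp [score, w, x, Prod.fst_sum, mul_comm]
  have hw2 : ∀ n ω k, (score n (X n) fun i => ε i ω).2 k = w n (Sum.inr k) ω := fun n ω k => by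
    simp [score, w, x, Prod.snd_sum, mul_comm]
  have hxK : ∀ n j, ∀ i < n, |x n i j| ≤ K := by
    intro n j i hi
    have h1 := hX n (by omega) i hi
    rcases j with j | j
    · exact (PiLp.norm_apply_le (X n i).1 j).trans ((norm_fst_le _).trans h1)
    · exact (PiLp.norm_apply_le (X n i).2 j).trans ((norm_snd_le _).trans h1)
  have hwi : ∀ n j, Integrable (fun ω => w n j ω ^ (2 * (k + 1))) P := fun n j =>
    integrable_pow_of_memLp (fun q => (memLp_sum_mul hL _ n q).const_mul _) _
  set c := (Fintype.card (Fin p₀ ⊕ Fin p₁) : ℝ) with hc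
  have hbound : ∀ n ω, (1 + ‖score n (X n) fun i => ε i ω‖) ^ k ≤ 2 ^ (2 * (k + 1))
      * (1 + c ^ (2 * k + 1) * ∑ j, w n j ω ^ (2 * (k + 1))) := by
    intro n ω
    refine le_trans ?_ (one_add_sum_abs_pow_le k fun j => w n j ω)
    refine (pow_le_pow_right₀ (by linarith [norm_nonneg (score n (X n) fun i => ε i ω)])
      (by omega : k ≤ 2 * (k + 1))).trans ?_
    gcongr
    rw [Fintype.sum_sum_type, Prod.norm_def]
    have n1 := norm_le_sum_abs (score n (X n) fun i => ε i ω).1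
    have n2 := norm_le_sum_abs (score n (X n) fun i => ε i ω).2
    simp only [hw1] at n1
    simp only [hw2] at n2
    have n3 : 0 ≤ ∑ k, |w n (Sum.inl k) ω| := Finset.sum_nonneg fun k _ => abs_nonneg _
    have n4 : 0 ≤ ∑ k, |w n (Sum.inr k) ω| := Finset.sum_nonneg fun k _ => abs_nonneg _
    exact max_le (by linarith) (by linarith)
  have hi1 : ∀ n, Integrable (fun ω => ∑ j, w n j ω ^ (2 * (k + 1))) P := fun n =>
    integrable_finsetSum _ fun j _ => hwi n j
  have hi2 : ∀ n, Integrable (fun ω => c ^ (2 * k + 1) * ∑ j, w n j ω ^ (2 * (k + 1))) P :=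
    fun n => (hi1 n).const_mul _
  have hi3 : ∀ n, Integrable (fun ω => 1 + c ^ (2 * k + 1) * ∑ j, w n j ω ^ (2 * (k + 1))) P :=
    fun n => (integrable_const 1).add (hi2 n)
  have hint : ∀ n, Integrable (fun ω => (1 + ‖score n (X n) fun i => ε i ω‖) ^ k) P := fun n => by
    refine ((hi3 n).const_mul (2 ^ (2 * (k + 1)))).mono' ?_ (ae_of_all _ fun ω => ?_)
    · have := (aemeasurable_score (fun i => (hL i 1).1.aemeasurable) n (X n)).norm
      exact ((this.const_add 1).pow_const k).aestronglyMeasurable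
    · rw [Real.norm_of_nonneg (by positivity)]
      exact hbound n ω
  refine ⟨2 ^ (2 * (k + 1)) * (1 + c ^ (2 * k + 1) * (c * C)), fun n => ⟨hint n, ?_⟩⟩
  refine (integral_mono (hint n) ((hi3 n).const_mul _) (hbound n)).trans ?_
  rw [integral_const_mul, integral_add (integrable_const 1) (hi2 n), integral_const_mul,
    integral_finsetSum _ fun j _ => hwi n j]
  simp only [integral_const, probReal_univ, one_smul]
  gcongr
  refine (Finset.sum_le_sum fun j _ => h n (fun i => x n i j) (hxK n j)).trans (le_of_eq ?_)
  simp [hc]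

/-! ### Asymptotic normality of the center -/

omit [IsProbabilityMeasure P] in
theorem multivariateGaussian_eq_map_add {p : ℕ} (b : EuclideanSpace ℝ (Fin p))
    (S : Matrix (Fin p) (Fin p) ℝ) :
    multivariateGaussian b S = (multivariateGaussian 0 S).map (fun v => v + b) := by
  rw [multivariateGaussian, multivariateGaussian, Measure.map_map (by fun_prop) (by fun_prop)]
  congr 1
  ext x
  simp [add_comm]

theorem tendstoInDistribution_center (hindep : iIndepFun ε P)
    (hident : ∀ i, IdentDistrib (ε i) (ε 0) P P) (hmean : ∫ ω, ε 0 ω ∂P = 0)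
    (hL : MemLp (ε 0) 2 P) {K : ℝ} (hX : ∀ n : ℕ, 0 < n → ∀ i < n, ‖X n i‖ ≤ K)
    {B₀ : Matrix (Fin p₁) (Fin p₁) ℝ} (hB₀ : B₀.PosDef)
    (hB : Tendsto (fun n : ℕ => frobNorm (gramRho n (X n) - B₀)) atTop (𝓝 0))
    (γ lam₀ : ℝ) (ρ₀ : EuclideanSpace ℝ (Fin p₁)) :
    TendstoInDistribution
      (fun n ω => ((0, center B₀ lam₀ γ ρ₀ (score n (X n) fun i => ε i ω).2) : Vec p₀ p₁)) atTop
      (fun v => (0, v + WithLp.toLp 2 (-(lam₀ • B₀⁻¹.mulVec (upsilon γ ρ₀))))) (fun _ => P)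
      (multivariateGaussian 0 ((∫ ω, ε 0 ω ^ 2 ∂P) • B₀⁻¹)) := by
  set A := Matrix.toEuclideanCLM (𝕜 := ℝ) B₀⁻¹ with hA
  have hdet : IsUnit B₀.det := hB₀.det_pos.ne'.isUnit
  have hsymm : B₀⁻¹.transpose = B₀⁻¹ := by simpa using hB₀.inv.isHermitian.eq
  have hAinner : ∀ x t, inner ℝ (A x) t = inner ℝ x (A t) := fun x t => by
    rw [real_inner_comm, hA, Matrix.inner_toEuclideanCLM, Matrix.inner_toEuclideanCLM,
      Matrix.dotProduct_mulVec, ← Matrix.mulVec_transpose, hsymm, dotProduct_comm]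
  have hAB : ∀ t, matForm B₀ (A t) (A t) = t.ofLp ⬝ᵥ B₀⁻¹.mulVec t.ofLp := fun t => by
    rw [matForm, hA, Matrix.ofLp_toEuclideanCLM, Matrix.mulVec_mulVec, Matrix.mul_nonsing_inv _ hdet,
      Matrix.one_mulVec, dotProduct_comm]
  have h1 := tendstoInDistribution_weighted_sum hindep hident hmean hL
    (x := fun n i => A (X n i).2) (K := ‖A‖ * K) (S := B₀⁻¹) (fun n hn i hi =>
      (A.le_opNorm _).trans (by gcongr; exact (norm_snd_le _).trans (hX n hn i hi)))
    hB₀.inv.posSemidef fun t => by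
      simp only [hAinner]
      rw [← hAB t]
      simp only [← matForm_gramRho]
      rw [tendsto_iff_dist_tendsto_zero]
      refine squeeze_zero (fun _ => dist_nonneg) (fun n => ?_)
        (by simpa using hB.mul_const (‖A t‖ * ‖A t‖))
      rw [Real.dist_eq, ← matForm_sub]
      exact abs_matForm_le _ _ _
  have h2 := h1.continuous_comp (g := fun w => ((0,
    w + WithLp.toLp 2 (-(lam₀ • B₀⁻¹.mulVec (upsilon γ ρ₀)))) : Vec p₀ p₁)) (by fun_prop)
  refine h2.congr (fun n => ae_of_all _ fun ω => ?_) (ae_of_all _ fun _ => rfl)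
  symm
  simp only [Function.comp_apply, Prod.mk.injEq, true_and]
  have e1 : (score n (X n) fun i => ε i ω).2
      = (√(n : ℝ))⁻¹ • ∑ i ∈ Finset.range n, ε i ω • (X n i).2 := by
    simp [score, Prod.snd_sum]
  have e2 : A (lam₀ • WithLp.toLp 2 (upsilon γ ρ₀))
      = WithLp.toLp 2 (lam₀ • B₀⁻¹.mulVec (upsilon γ ρ₀)) := by
    rw [map_smul, hA, Matrix.toEuclideanCLM_toLp, WithLp.toLp_smul]
  rw [center, ← hA, map_sub, e1, e2, WithLp.toLp_neg, ← sub_eq_add_neg]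
  simp [map_sum]

end Score

theorem memLp_of_integrable_abs_rpow {Ω : Type*} [MeasurableSpace Ω] {P : Measure Ω}
    {f : Ω → ℝ} (hf : AEMeasurable f P)
    (h : ∀ k : ℝ, 0 < k → Integrable (fun ω => |f ω| ^ k) P) (k : ℕ) : MemLp f k P := by
  rcases Nat.eq_zero_or_pos k with rfl | hk
  · simpa using hf.aestronglyMeasurable
  · rw [← integrable_norm_rpow_iff hf.aestronglyMeasurable (by exact_mod_cast hk.ne') (by simp)]
    simpa using h k (by exact_mod_cast hk)

theorem measureReal_le_div_of_ae_le {Ω : Type*} [MeasurableSpace Ω] {P : Measure Ω}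
    [IsProbabilityMeasure P] {f g : Ω → ℝ} (hfg : ∀ᵐ ω ∂P, f ω ≤ g ω) (hg : ∀ ω, 0 ≤ g ω)
    (hgi : Integrable g P) {M r : ℝ} (hM : ∫ ω, g ω ∂P ≤ M) (hr : 0 < r) :
    P.real {ω | r ≤ f ω} ≤ M / r := by
  have h1 : P.real {ω | r ≤ f ω} ≤ P.real {ω | r ≤ g ω} := by
    refine ENNReal.toReal_mono (measure_ne_top _ _) (measure_mono_ae ?_)
    filter_upwards [hfg] with ω hω h
    exact le_trans (show r ≤ f ω from h) hω
  have h2 := mul_meas_ge_le_integral_of_nonneg (ae_of_all P hg) hgi r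
  rw [le_div_iff₀ hr, mul_comm]
  exact (mul_le_mul_of_nonneg_left h1 hr.le).trans (h2.trans hM)

theorem exists_norm_scaledError_le {p₀ p₁ : ℕ} {Θ : Set (Vec p₀ p₁)} (hΘ : IsCompact Θ)
    (ρ₀ : EuclideanSpace ℝ (Fin p₁)) (N : ℕ) :
    ∃ R : ℝ, ∀ n ≤ N, ∀ θ ∈ Θ, ‖scaledError ρ₀ n θ‖ ≤ R := by
  obtain ⟨R, hR⟩ := hΘ.exists_bound_of_continuousOn (f := fun θ : Vec p₀ p₁ => (θ.1, θ.2 - ρ₀))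
    (by fun_prop)
  refine ⟨√(N : ℝ) * R, fun n hn θ hθ => ?_⟩
  have : scaledError ρ₀ n θ = √(n : ℝ) • (θ.1, θ.2 - ρ₀) := rfl
  rw [this, norm_smul, Real.norm_of_nonneg (Real.sqrt_nonneg _)]
  gcongr
  exact hR θ hθ

theorem integrable_one_add_norm_pow_of_isGaussian {p : ℕ} (μ : Measure (EuclideanSpace ℝ (Fin p)))
    [IsGaussian μ] (b : EuclideanSpace ℝ (Fin p)) (k : ℕ) :
    Integrable (fun v => (1 + ‖v + b‖) ^ k) μ := by
  refine integrable_pow_of_memLp (fun q => ?_) k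
  have h1 : MemLp (fun v : EuclideanSpace ℝ (Fin p) => v) q μ :=
    IsGaussian.memLp_id μ q (ENNReal.natCast_ne_top q)
  have h2 : MemLp (fun v => v + b) q μ := h1.add (memLp_const b)
  have h3 : MemLp (fun v => ‖v + b‖) q μ := h2.norm
  exact (memLp_const (1 : ℝ)).add h3

end SparseBridge

theorem mainTheorem5 {Ω : Type*} [MeasurableSpace Ω] (P : Measure Ω) [IsProbabilityMeasure P]
    {p₀ p₁ : ℕ}
    -- noise: i.i.d., centered, with moments of all orders
    (ε : ℕ → Ω → ℝ)
    (hindep : iIndepFun ε P)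
    (hident : ∀ i, IdentDistrib (ε i) (ε 0) P P)
    (hmean : ∀ i, ∫ ω, ε i ω ∂P = 0)
    (hmom : ∀ i, ∀ k : ℝ, 0 < k → Integrable (fun ω => |ε i ω| ^ k) P)
    -- parameter space `Θ₀ × Θ₁` and true value `(0, ρ₀)`
    (Θ₀ : Set (EuclideanSpace ℝ (Fin p₀))) (Θ₁ : Set (EuclideanSpace ℝ (Fin p₁)))
    (hΘ₀ : IsCompact Θ₀) (hΘ₁ : IsCompact Θ₁)
    (ρ₀ : EuclideanSpace ℝ (Fin p₁)) (hρ₀ : ∀ l, ρ₀ l ≠ 0)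
    (hz_int : (0 : EuclideanSpace ℝ (Fin p₀)) ∈ interior Θ₀) (hρ_int : ρ₀ ∈ interior Θ₁)
    -- bridge index and tuning parameters
    (γ : ℝ) (hγ₀ : 0 < γ) (hγ₁ : γ < 1)
    (lam : ℕ → ℝ) (lam₀ : ℝ) (hlam₀ : 0 ≤ lam₀)
    (hlam_top : Tendsto (fun n : ℕ => lam n / (n : ℝ) ^ (γ / 2)) atTop atTop)
    (hlam_lim : Tendsto (fun n : ℕ => lam n / √(n : ℝ)) atTop (𝓝 lam₀))
    -- non-random design
    (X : ℕ → ℕ → SparseBridge.Vec p₀ p₁)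
    (hX : ∃ K : ℝ, ∀ n : ℕ, 0 < n → ∀ i < n, ‖X n i‖ ≤ K)
    (D₀ : Matrix (Fin p₀) (Fin p₀) ℝ) (hD₀ : D₀.PosDef)
    (hD : Tendsto (fun n : ℕ => SparseBridge.gramZ n (X n)) atTop (𝓝 D₀))
    (B₀ : Matrix (Fin p₁) (Fin p₁) ℝ) (hB₀ : B₀.PosDef)
    (hB : ∃ δ : ℝ, 0 < δ ∧ ∃ K : ℝ, ∀ n : ℕ, 0 < n →
      (n : ℝ) ^ δ * SparseBridge.frobNorm (SparseBridge.gramRho n (X n) - B₀) ≤ K)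
    (hcross : ∃ K : ℝ, ∀ n : ℕ, 0 < n →
      SparseBridge.frobNorm (SparseBridge.cross n (X n)) ≤ K)
    -- the estimator `(ẑ_n, ρ̂_n)`: any measurable minimizer of the contrast over `Θ₀ × Θ₁`
    (θhat : ℕ → Ω → SparseBridge.Vec p₀ p₁)
    (hmeas : ∀ n : ℕ, 0 < n → AEMeasurable (θhat n) P)
    (hmem : ∀ n : ℕ, 0 < n → ∀ᵐ ω ∂P, θhat n ω ∈ Θ₀ ×ˢ Θ₁)
    (hmin : ∀ n : ℕ, 0 < n → ∀ᵐ ω ∂P,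
      IsMinOn
        (SparseBridge.contrast n (X n)
          (fun i => SparseBridge.response X ε (0, ρ₀) n i ω) (lam n) γ)
        (Θ₀ ×ˢ Θ₁) (θhat n ω)) :
    (∀ L : ℝ, 0 < L → ∃ c : ℝ, 0 < c ∧ ∀ n : ℕ, 0 < n → ∀ r : ℝ, 0 < r →
      P.real {ω | r ≤ max ‖√(n : ℝ) • (θhat n ω).1‖ ‖√(n : ℝ) • ((θhat n ω).2 - ρ₀)‖}
        ≤ c / r ^ L)
    ∧ ∀ f : SparseBridge.Vec p₀ p₁ → ℝ, Continuous f →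
      (∃ K : ℝ, ∃ q : ℕ, ∀ x, |f x| ≤ K * (1 + ‖x‖) ^ q) →
        (∀ n : ℕ, 0 < n →
          Integrable (fun ω => f (SparseBridge.scaledError ρ₀ n (θhat n ω))) P)
        ∧ Integrable (fun v => f (0, v))
            (SparseBridge.limitLaw γ lam₀ (∫ ω, ε 0 ω ^ 2 ∂P) B₀ ρ₀)
        ∧ Tendsto (fun n : ℕ => ∫ ω, f (SparseBridge.scaledError ρ₀ n (θhat n ω)) ∂P) atTop
            (𝓝 (∫ v, f (0, v)
              ∂(SparseBridge.limitLaw γ lam₀ (∫ ω, ε 0 ω ^ 2 ∂P) B₀ ρ₀))) := by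
  have hεm : ∀ i, AEMeasurable (ε i) P := fun i => (hident i).aemeasurable_fst
  have hL : ∀ i, ∀ k : ℕ, MemLp (ε i) k P := fun i => SparseBridge.memLp_of_integrable_abs_rpow (hεm i) (hmom i)
  have hbd : ∀ k : ℕ, ∃ M : ℝ, ∀ i, ∫ ω, |ε i ω| ^ k ∂P ≤ M := fun k =>
    ⟨∫ ω, |ε 0 ω| ^ k ∂P, fun i => ((hident i).comp (u := fun x => |x| ^ k)
      (by fun_prop)).integral_eq.le⟩
  obtain ⟨KX, hKX⟩ := hX
  obtain ⟨δ, hδ, KB, hKB⟩ := hB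
  obtain ⟨KG, hKG⟩ := hcross
  have hB' := SparseBridge.tendsto_frobNorm_sub_of_rate hδ hKB
  have hscore := SparseBridge.exists_integral_one_add_norm_score_pow_le hindep hL hmean hbd hKX
  obtain ⟨C₀, hC₀, a, ha, m, happ⟩ := SparseBridge.exists_scaledError_approx hρ₀ hz_int hρ_int hγ₀ hγ₁ hlam_top
    hlam_lim hD₀ hD hB₀ hB' hKG
  obtain ⟨N, hN⟩ := eventually_atTop.1 happ
  obtain ⟨R, hR⟩ := SparseBridge.exists_norm_scaledError_le (hΘ₀.prod hΘ₁) ρ₀ N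
  set T : ℕ → Ω → ℝ := fun n ω => 1 + ‖SparseBridge.score n (X n) fun i => ε i ω‖ with hT
  have hT1 : ∀ n ω, 1 ≤ T n ω := fun n ω => by
    simp only [hT]; linarith [norm_nonneg (SparseBridge.score n (X n) fun i => ε i ω)]
  set C := max 1 (max C₀ R) with hC
  have hC1 : 1 ≤ C := le_max_left _ _
  have hbound : ∀ n : ℕ, ∀ᵐ ω ∂P, ‖SparseBridge.scaledError ρ₀ n (θhat n ω)‖ ≤ C * T n ω := by
    intro n
    rcases Nat.eq_zero_or_pos n with rfl | hn
    · refine ae_of_all _ fun ω => ?_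
      have : SparseBridge.scaledError ρ₀ 0 (θhat 0 ω) = 0 := by simp [SparseBridge.scaledError]
      rw [this, norm_zero]
      have := hT1 0 ω
      positivity
    · filter_upwards [hmem n hn, hmin n hn] with ω h1 h2
      rcases le_or_gt n N with h | h
      · calc _ ≤ R := hR n h _ h1
          _ ≤ C := (le_max_right _ _).trans (le_max_right _ _)
          _ ≤ _ := le_mul_of_one_le_right (by positivity) (hT1 n ω)
      · refine (hN n h.le (fun i => ε i ω) _ h1 h2).1.trans ?_
        have := hT1 n ω
        gcongr
        exact (le_max_left _ _).trans (le_max_right _ _)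
  constructor
  · intro L hL0
    obtain ⟨M, hM⟩ := hscore ⌈L⌉₊
    have hM0 : 0 ≤ M := (integral_nonneg fun ω => by positivity).trans (hM 0).2
    refine ⟨C ^ ⌈L⌉₊ * M + 1, by positivity, fun n hn r hr => ?_⟩
    have hset : {ω | r ≤ max ‖√(n : ℝ) • (θhat n ω).1‖ ‖√(n : ℝ) • ((θhat n ω).2 - ρ₀)‖}
        = {ω | r ^ L ≤ ‖SparseBridge.scaledError ρ₀ n (θhat n ω)‖ ^ L} := by
      ext ω
      exact (Real.rpow_le_rpow_iff hr.le
        (norm_nonneg (SparseBridge.scaledError ρ₀ n (θhat n ω))) hL0).symm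
    rw [hset]
    refine SparseBridge.measureReal_le_div_of_ae_le (g := fun ω => C ^ ⌈L⌉₊ * T n ω ^ ⌈L⌉₊) ?_
      (fun ω => ?_) ((hM n).1.const_mul _) ?_ (by positivity)
    · filter_upwards [hbound n] with ω hω
      have h1 : 1 ≤ C * T n ω := one_le_mul_of_one_le_of_one_le hC1 (hT1 n ω)
      rw [← mul_pow, ← Real.rpow_natCast]
      exact (Real.rpow_le_rpow (norm_nonneg _) hω hL0.le).trans
        (Real.rpow_le_rpow_of_exponent_le h1 (Nat.le_ceil L))
    · have := hT1 n ω
      positivity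
    · rw [integral_const_mul]
      have := mul_le_mul_of_nonneg_left (hM n).2 (by positivity : 0 ≤ C ^ ⌈L⌉₊)
      linarith
  · intro f hf ⟨K, q, hK⟩
    set Y : ℕ → Ω → SparseBridge.Vec p₀ p₁ := fun n ω => SparseBridge.scaledError ρ₀ n (θhat n ω) with hY
    have hYm : ∀ n, AEMeasurable (Y n) P := by
      intro n
      rcases Nat.eq_zero_or_pos n with rfl | hn
      · have : Y 0 = fun _ => 0 := by ext1 ω; simp [hY, SparseBridge.scaledError]
        rw [this]; exact aemeasurable_const
      · have hc : Continuous (SparseBridge.scaledError ρ₀ n : SparseBridge.Vec p₀ p₁ → SparseBridge.Vec p₀ p₁) := by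
          unfold SparseBridge.scaledError; fun_prop
        exact hc.measurable.comp_aemeasurable (hmeas n hn)
    have hYT : ∀ n k, ∀ᵐ ω ∂P, (1 + ‖Y n ω‖) ^ k ≤ (2 * C) ^ k * T n ω ^ k := by
      intro n k
      filter_upwards [hbound n] with ω hω
      rw [← mul_pow]
      have := one_le_mul_of_one_le_of_one_le hC1 (hT1 n ω)
      refine pow_le_pow_left₀ (by positivity) ?_ k
      simp only [hY]
      linarith
    have hYi : ∀ n k : ℕ, Integrable (fun ω => (1 + ‖Y n ω‖) ^ k) P := by
      intro n k
      obtain ⟨M, hM⟩ := hscore k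
      have hYn : AEMeasurable (fun ω => ‖Y n ω‖) P := (hYm n).norm
      refine ((hM n).1.const_mul ((2 * C) ^ k)).mono'
        ((hYn.const_add 1).pow_const k).aestronglyMeasurable ?_
      filter_upwards [hYT n k] with ω hω
      rwa [Real.norm_of_nonneg (by positivity)]
    have hYb : ∀ k : ℕ, ∃ M : ℝ, ∀ n, ∫ ω, (1 + ‖Y n ω‖) ^ k ∂P ≤ M := by
      intro k
      obtain ⟨M, hM⟩ := hscore k
      refine ⟨(2 * C) ^ k * M, fun n => ?_⟩
      refine (integral_mono_ae (hYi n k) ((hM n).1.const_mul _) (hYT n k)).trans ?_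
      rw [integral_const_mul]
      gcongr
      exact (hM n).2
    set σ2 := ∫ ω, ε 0 ω ^ 2 ∂P with hσ2
    set b : EuclideanSpace ℝ (Fin p₁) :=
      WithLp.toLp 2 (-(lam₀ • B₀⁻¹.mulVec (SparseBridge.upsilon γ ρ₀))) with hb
    have hV := SparseBridge.tendstoInDistribution_center hindep hident (hmean 0) (by exact_mod_cast hL 0 2) hKX
      hB₀ hB' γ lam₀ ρ₀
    have hYV : TendstoInMeasure P (Y - fun n ω =>
        ((0, SparseBridge.center B₀ lam₀ γ ρ₀ (SparseBridge.score n (X n) fun i => ε i ω).2) : SparseBridge.Vec p₀ p₁)) atTop 0 := by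
      rw [tendstoInMeasure_iff_measureReal_norm]
      intro η hη
      obtain ⟨M, hM⟩ := hscore m
      have h0 : Tendsto (fun n => |a n| * M / η) atTop (𝓝 0) := by
        have := (ha.abs.mul_const M).div_const η
        simpa using this
      refine squeeze_zero' (Eventually.of_forall fun n => measureReal_nonneg) ?_ h0
      filter_upwards [eventually_ge_atTop N, eventually_gt_atTop 0] with n hn hn0
      refine SparseBridge.measureReal_le_div_of_ae_le (g := fun ω => |a n| * T n ω ^ m) ?_ (fun ω => ?_)
        ((hM n).1.const_mul _) ?_ hη
      · filter_upwards [hmem n hn0, hmin n hn0] with ω h1 h2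
        have := (hN n hn (fun i => ε i ω) _ h1 h2).2
        have h3 := hT1 n ω
        simp only [Pi.sub_apply, Pi.zero_apply, sub_zero]
        refine this.trans ?_
        change a n * T n ω ^ m ≤ _
        gcongr
        exact le_abs_self _
      · have := hT1 n ω
        positivity
      · rw [integral_const_mul]
        exact mul_le_mul_of_nonneg_left (hM n).2 (abs_nonneg _)
    have hYZ := tendstoInDistribution_of_tendstoInMeasure_sub Y _ hV hYV hYm
    have hlaw : SparseBridge.limitLaw γ lam₀ σ2 B₀ ρ₀
        = (multivariateGaussian 0 (σ2 • B₀⁻¹)).map (fun v => v + b) :=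
      SparseBridge.multivariateGaussian_eq_map_add _ _
    have hf0 : Continuous fun v : EuclideanSpace ℝ (Fin p₁) => f ((0, v) : SparseBridge.Vec p₀ p₁) := by
      fun_prop
    have hnorm : ∀ v : EuclideanSpace ℝ (Fin p₁), ‖((0, v) : SparseBridge.Vec p₀ p₁)‖ = ‖v‖ := fun v => by
      simp [Prod.norm_def]
    have hZi : ∀ k : ℕ, Integrable (fun v => (1 + ‖((0, v + b) : SparseBridge.Vec p₀ p₁)‖) ^ k)
        (multivariateGaussian 0 (σ2 • B₀⁻¹)) := fun k => by
      simp only [hnorm]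
      exact SparseBridge.integrable_one_add_norm_pow_of_isGaussian _ b k
    refine ⟨fun n _ => ?_, ?_, ?_⟩
    · exact ((hYi n q).const_mul K).mono' (hf.measurable.comp_aemeasurable (hYm n)).aestronglyMeasurable
        (ae_of_all _ fun ω => hK _)
    · rw [hlaw, integrable_map_measure hf0.measurable.aestronglyMeasurable (by fun_prop)]
      refine ((hZi q).const_mul K).mono' ?_ (ae_of_all _ fun v => hK _)
      exact (hf0.comp (continuous_add_const b)).measurable.aestronglyMeasurable
    · rw [hlaw, integral_map (by fun_prop) hf0.measurable.aestronglyMeasurable]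
      exact SparseBridge.tendsto_integral_of_polynomial_growth hYZ hYi hYb hZi hf hK
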